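/- For $\alpha\in(0,1)\cup(1,2)$ let $q=0$ if $0<\alpha<1$ and $q=1$ if $1<\alpha<2$. For $h>0$, $p,k\in\mathbb{R}$ put $$\psi_h^p(k)=(-1)^{q+1}h^{-\alpha}e^{-ipkh}\,(1-e^{ikh})^{\alpha}$$ (principal branch of the power), and let $$\phi_h(k)=a\,\psi_h^{p_1}(k)+(1-a)\,\psi_{2h}^{p_2}(k),$$ where $a=2$, $p_1=p_2=0$ if $0<\alpha<1$, and $a=2-\frac{2}{\alpha}$, $p_1=1$, $p_2=\frac12$ if $1<\alpha<2$. Let $X=L_1(\mathbb{R}_+)$ if $0<\alpha<1$ and $X=L_1(\mathbb{R})$ if $1<\alpha<2$ (complex-valued functions; $\mathbb{R}_+=[0,\infty)$, and functions on $\mathbb{R}_+$ are extended by $0$), and write $\hat f(k)=\int e^{ikx}f(x)\,dx$ for $f\in X$. A measurable function $\psi:\mathbb{R}\to\mathbb{C}$ is called a multiplier on $X$ if for every $f\in X$ there is $v\in X$ with $\psi\hat f=\hat v$; then $T_\psi f:=v$ defines a bounded linear operator $T_\psi$ on $X$. **Theorem 4.5.** For every such $\alpha$: 1. For every $h>0$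 and $t\ge 0$ the functions $\phi_h$ and $e^{t\phi_h}$ are multipliers on $X$, and for every $h>0$ the family $\{T_{e^{t\phi_h}}\}_{t\ge 0}$ is a strongly continuous semigroup on $X$ with generator $T_{\phi_h}$. 2. These semigroups are bounded uniformly in $h$ and $t$: there is $K$ such that $\|T_{e^{t\phi_h}}\|_{\mathcal{B}(X)}\le K$ for all $h>0$, $t\ge 0$. 3. They are uniformly analytic in $h$: there is $M>0$ such that for all $t,h>0$ the function $\phi_h e^{t\phi_h}$ is a multiplier on $X$ and $\|T_{\phi_h e^{t\phi_h}}\|_{\mathcal{B}(X)}\le M t^{-1}$. The constants $K$ and $M$ may depend on $\alpha$, but not on $h$ or $t$. -/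

import Mathlib

namespace Grunwald

noncomputable section

open MeasureTheory Set Filter Topology

/-! The complex space `L₁` over a measure `μ` on `ℝ`. The two cases of interest are `L₁(ℝ)`, where
`μ` is Lebesgue measure, and `L₁(ℝ₊)`, where `μ` is Lebesgue measure on `[0, ∞)`. -/

/-- The space `L₁(μ)` of complex-valued integrable functions, modulo null sets. -/
abbrev L1 (μ : Measure ℝ) : Type := Lp ℂ 1 μ

/-- Lebesgue measure on the half-line `[0, ∞)`, so that `L1 halfLine` is `L₁(ℝ₊)`. -/
abbrev halfLine : Measure ℝ := volume.restrict (Ici (0 : ℝ))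

/-- The Fourier transform `k ↦ ∫ e^{ikx} f(x) dx` of `f ∈ L₁`. For `μ = halfLine` this is the
Fourier transform of the extension of `f` by zero. -/
def fourierL1 {μ : Measure ℝ} (f : L1 μ) (k : ℝ) : ℂ :=
  ∫ x, Complex.exp (Complex.I * k * x) * f x ∂μ

/-- `ψ` is an `L₁`-multiplier: it is measurable, and for every `f ∈ L₁` the product of `ψ` with the
Fourier transform of `f` is the Fourier transform of some `v ∈ L₁`. -/
def IsL1Multiplier (μ : Measure ℝ) (ψ : ℝ → ℂ) : Prop :=
  Measurable ψ ∧ ∀ f : L1 μ, ∃ v : L1 μ, ∀ k : ℝ, ψ k * fourierL1 f k = fourierL1 v k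

theorem integrable_exp_mul {μ : Measure ℝ} (f : L1 μ) (k : ℝ) :
    Integrable (fun x : ℝ => Complex.exp (Complex.I * k * x) * f x) μ := by
  refine (L1.integrable_coeFn f).bdd_mul (c := 1) (by fun_prop) ?_
  refine Eventually.of_forall fun x => ?_
  have : Complex.I * k * x = ((k * x : ℝ) : ℂ) * Complex.I := by push_cast; ring
  rw [this, Complex.norm_exp_ofReal_mul_I]

theorem fourierL1_add {μ : Measure ℝ} (f g : L1 μ) (k : ℝ) :
    fourierL1 (f + g) k = fourierL1 f k + fourierL1 g k := by
  unfold fourierL1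
  rw [← integral_add (integrable_exp_mul f k) (integrable_exp_mul g k)]
  refine integral_congr_ae ?_
  filter_upwards [Lp.coeFn_add f g] with x hx
  rw [hx, Pi.add_apply]; ring

theorem fourierL1_smul {μ : Measure ℝ} (c : ℂ) (f : L1 μ) (k : ℝ) :
    fourierL1 (c • f) k = c * fourierL1 f k := by
  unfold fourierL1
  rw [← integral_const_mul]
  refine integral_congr_ae ?_
  filter_upwards [Lp.coeFn_smul c f] with x hx
  rw [hx, Pi.smul_apply, smul_eq_mul]; ring

theorem norm_fourierL1_le {μ : Measure ℝ} (f : L1 μ) (k : ℝ) : ‖fourierL1 f k‖ ≤ ‖f‖ := by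
  unfold fourierL1
  rw [L1.norm_eq_integral_norm]
  refine (norm_integral_le_integral_norm _).trans (le_of_eq ?_)
  refine integral_congr_ae (Eventually.of_forall fun x => ?_)
  have : Complex.I * k * x = ((k * x : ℝ) : ℂ) * Complex.I := by push_cast; ring
  simp only [norm_mul]
  rw [this, Complex.norm_exp_ofReal_mul_I, one_mul]

theorem continuous_fourierL1 {μ : Measure ℝ} (k : ℝ) :
    Continuous fun f : L1 μ => fourierL1 f k := by
  let l : L1 μ →ₗ[ℂ] ℂ :=
    { toFun := fun f => fourierL1 f k
      map_add' := fun f g => fourierL1_add f g k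
      map_smul' := fun c f => fourierL1_smul c f k }
  exact (l.mkContinuous 1 fun f => by
    rw [one_mul]; exact norm_fourierL1_le f k).continuous

/-- An element of `L₁` with vanishing Fourier transform is zero. -/
theorem eq_zero_of_fourierL1 {μ : Measure ℝ} [SigmaFinite μ] (f : L1 μ)
    (hf : ∀ k, fourierL1 f k = 0) : f = 0 := by
  have key : ∀ g : SchwartzMap ℝ ℂ, ∫ x, f x • g x ∂μ = 0 := by
    intro g
    have hflip := VectorFourier.integral_fourierIntegral_smul_eq_flip
      (e := Real.fourierChar) (μ := μ) (ν := (volume : Measure ℝ)) (L := innerₗ ℝ)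
      (f := (f : ℝ → ℂ)) (g := (FourierTransformInv.fourierInv g : SchwartzMap ℝ ℂ))
      Real.continuous_fourierChar (by exact continuous_inner) (L1.integrable_coeFn f)
      (SchwartzMap.integrable _)
    have h0 : ∀ ξ : ℝ, VectorFourier.fourierIntegral Real.fourierChar μ (innerₗ ℝ)
        (f : ℝ → ℂ) ξ = 0 := by
      intro ξ
      rw [← hf (-(2 * Real.pi * ξ))]
      unfold VectorFourier.fourierIntegral fourierL1
      refine integral_congr_ae (Eventually.of_forall fun x => ?_)
      simp only [Circle.smul_def, Real.fourierChar_apply, smul_eq_mul]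
      congr 2
      simp
      ring
    have h1 : ∀ x : ℝ, VectorFourier.fourierIntegral Real.fourierChar (volume : Measure ℝ)
        (innerₗ ℝ).flip ((FourierTransformInv.fourierInv g : SchwartzMap ℝ ℂ) : ℝ → ℂ) x = g x := by
      intro x
      have h2 : FourierTransform.fourier (FourierTransformInv.fourierInv g : SchwartzMap ℝ ℂ) = g :=
        FourierTransform.fourier_fourierInv_eq g
      conv_rhs => rw [← h2, SchwartzMap.fourier_coe]
      rw [flip_innerₗ]
      rfl
    simp only [h0, h1, zero_smul, integral_zero] at hflip
    exact hflip.symm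
  rw [Lp.eq_zero_iff_ae_eq_zero]
  refine ae_eq_zero_of_integral_contDiff_smul_eq_zero
    (L1.integrable_coeFn f).locallyIntegrable fun g hg hgc => ?_
  have hc : HasCompactSupport fun x => (g x : ℂ) := hgc.comp_left (g := Complex.ofReal) rfl
  have := key (hc.toSchwartzMap (Complex.ofRealCLM.contDiff.comp hg))
  rw [← this]
  refine integral_congr_ae (Eventually.of_forall fun x => ?_)
  change (g x : ℝ) • f x = f x • (g x : ℂ)
  rw [smul_eq_mul, mul_comm, Complex.real_smul]

/-- Uniqueness of Fourier transforms on `L₁`. -/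
theorem fourierL1_injective {μ : Measure ℝ} [SigmaFinite μ] {f g : L1 μ}
    (h : ∀ k, fourierL1 f k = fourierL1 g k) : f = g := by
  rw [← sub_eq_zero]
  refine eq_zero_of_fourierL1 _ fun k => ?_
  have : f - g = f + (-1 : ℂ) • g := by simp [sub_eq_add_neg]
  rw [this, fourierL1_add, fourierL1_smul, h k]; ring

open Classical in
/-- The operator `T_ψ : L₁ → L₁` of an `L₁`-multiplier `ψ`, mapping `f` to the unique `v` whose
Fourier transform is `ψ` times that of `f`; it is bounded by the closed graph theorem.
(If `ψ` is not a multiplier, the value is `0` by convention.) -/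
def multiplierOp (μ : Measure ℝ) [SigmaFinite μ] (ψ : ℝ → ℂ) : L1 μ →L[ℂ] L1 μ :=
  if h : IsL1Multiplier μ ψ then
    ContinuousLinearMap.ofSeqClosedGraph
      (g := { toFun := fun f => (h.2 f).choose
              map_add' := fun f g => fourierL1_injective fun k => by
                rw [fourierL1_add, ← (h.2 (f + g)).choose_spec k, ← (h.2 f).choose_spec k,
                  ← (h.2 g).choose_spec k, fourierL1_add]; ring
              map_smul' := fun c f => fourierL1_injective fun k => by
                rw [RingHom.id_apply, fourierL1_smul, ← (h.2 (c • f)).choose_spec k,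
                  ← (h.2 f).choose_spec k, fourierL1_smul]; ring })
      (by
        intro u x y hu hy
        refine fourierL1_injective fun k => ?_
        refine tendsto_nhds_unique (((continuous_fourierL1 k).tendsto y).comp hy) ?_
        have h1 := (((continuous_fourierL1 k).tendsto x).comp hu).const_mul (ψ k)
        rw [(h.2 x).choose_spec k] at h1
        refine h1.congr fun n => ?_
        exact (h.2 (u n)).choose_spec k)
  else 0

/-- The defining property of `T_ψ`. -/
theorem fourierL1_multiplierOp {μ : Measure ℝ} [SigmaFinite μ] {ψ : ℝ → ℂ}
    (h : IsL1Multiplier μ ψ) (f : L1 μ) (k : ℝ) :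
    fourierL1 (multiplierOp μ ψ f) k = ψ k * fourierL1 f k := by
  rw [multiplierOp, dif_pos h]
  exact ((h.2 f).choose_spec k).symm

/-- `{S(t)}_{t ≥ 0}` is a strongly continuous semigroup of bounded operators on `X`. Only the
values `S t` with `t ≥ 0` matter. -/
structure IsC0Semigroup {X : Type*} [NormedAddCommGroup X] [NormedSpace ℂ X]
    (S : ℝ → X →L[ℂ] X) : Prop where
  zero : S 0 = ContinuousLinearMap.id ℂ X
  add : ∀ s t : ℝ, 0 ≤ s → 0 ≤ t → S (s + t) = (S s).comp (S t)
  continuousOn : ∀ x : X, ContinuousOn (fun t => S t x) (Ici 0)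

/-- The everywhere defined operator `A` is the generator of the semigroup `S`. -/
def IsGenerator {X : Type*} [NormedAddCommGroup X] [NormedSpace ℂ X]
    (A : X →L[ℂ] X) (S : ℝ → X →L[ℂ] X) : Prop :=
  ∀ x : X, Tendsto (fun t : ℝ => (t : ℂ)⁻¹ • (S t x - x)) (𝓝[>] 0) (𝓝 (A x))

/-- The symbol of the `p`-shifted Grünwald formula with step `h`,
`ψ_h^p(k) = (-1)^{q+1} h^{-α} e^{-ipkh} (1 - e^{ikh})^α`, with the principal branch of the
power. -/
def grunwaldSymbol (α : ℝ) (q : ℕ) (p h k : ℝ) : ℂ :=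
  (-1) ^ (q + 1) * ((h ^ (-α) : ℝ) : ℂ) * Complex.exp (-Complex.I * p * k * h) *
    (1 - Complex.exp (Complex.I * k * h)) ^ (α : ℂ)

/-- The mixed symbol `φ_h(k) = a ψ_h^{p₁}(k) + (1 - a) ψ_{2h}^{p₂}(k)`. -/
def mixedSymbol (α : ℝ) (q : ℕ) (a p₁ p₂ h k : ℝ) : ℂ :=
  (a : ℂ) * grunwaldSymbol α q p₁ h k + (1 - (a : ℂ)) * grunwaldSymbol α q p₂ (2 * h) k

/-- A family of symbols `φ_h`, `h > 0`, generates on `L₁(μ)` strongly continuous semigroups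
`{T_{e^{tφ_h}}}_{t ≥ 0}`: the functions `φ_h` and `e^{tφ_h}` are `L₁`-multipliers, and the operators
`T_{e^{tφ_h}}` form a strongly continuous semigroup with generator `T_{φ_h}`. -/
def GenerateSemigroups (μ : Measure ℝ) [SigmaFinite μ] (φ : ℝ → ℝ → ℂ) : Prop :=
  ∀ h : ℝ, 0 < h →
    IsL1Multiplier μ (φ h) ∧
    (∀ t : ℝ, 0 ≤ t → IsL1Multiplier μ fun k => Complex.exp (t * φ h k)) ∧
    IsC0Semigroup (fun t : ℝ => multiplierOp μ fun k => Complex.exp (t * φ h k)) ∧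
    IsGenerator (multiplierOp μ (φ h))
      (fun t : ℝ => multiplierOp μ fun k => Complex.exp (t * φ h k))

/-- The operators `T_{e^{tφ_h}}` are bounded uniformly in `h > 0` and `t ≥ 0`. -/
def UniformlyBounded (μ : Measure ℝ) [SigmaFinite μ] (φ : ℝ → ℝ → ℂ) : Prop :=
  ∃ K : ℝ, ∀ h t : ℝ, 0 < h → 0 ≤ t →
    ‖multiplierOp μ fun k => Complex.exp (t * φ h k)‖ ≤ K

/-- The semigroups `{T_{e^{tφ_h}}}_{t ≥ 0}` are uniformly analytic in `h`: there is `M > 0` such that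
`‖T_{φ_h e^{tφ_h}}‖ ≤ M t⁻¹` for all `t, h > 0`, where each `φ_h e^{tφ_h}` is an `L₁`-multiplier. -/
def UniformlyAnalytic (μ : Measure ℝ) [SigmaFinite μ] (φ : ℝ → ℝ → ℂ) : Prop :=
  ∃ M : ℝ, 0 < M ∧ ∀ h t : ℝ, 0 < h → 0 < t →
    (IsL1Multiplier μ fun k => φ h k * Complex.exp (t * φ h k)) ∧
    ‖multiplierOp μ fun k => φ h k * Complex.exp (t * φ h k)‖ ≤ M * t⁻¹

end

end Grunwald

namespace Grunwald

noncomputable section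

open MeasureTheory Set Filter Topology

/-! For fixed `h` nothing is delicate. The coefficients of `(1 - z)^α` are absolutely summable for
`0 < α < 1`, so substituting translations for powers of `z = e^{ikh}` gives a bounded operator; for
`1 < α < 2` one splits off a factor `1 - z`. Hence `φ_h` is a multiplier and the semigroup is the
norm-continuous exponential of `T_{φ_h}`.

The content is uniformity in `h` and `t`. Both symbols scale: `φ_h(k) = h^{-α} G(hk)` for one
`2π`-periodic function `G` (`coreSymbol`). Thus `g(t φ_h(k)) = f(hk)` with `f = g(sG)` and `s = t
h^{-α}`. If `f` has Fourier coefficients `b_n`, the operator is the sum of `b_n` times translation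
by `nh`, of norm at most `∑ |b_n|`. It therefore suffices to bound this sum uniformly in `s > 0`,
for `g(z) = e^z` (boundedness) and `g(z) = z e^z` (analyticity, since `t φ_h e^{tφ_h}` is then
bounded).

Two facts about `G` enter. First, `Re G ≤ -c |1 - e^{ix}|^α`, which is where the choice of `a`,
`p₁`, `p₂` matters (`exists_re_bound_of_lt_one`, `exists_re_bound_of_one_lt`). Second, `G` is smooth
except for algebraic singularities at `0` and `π` (`exists_coreSymbol_bound`). Put `α = 2γ`, so that
`0 < γ < 1` in both cases, and `N = s^{1/α}`. Then `f` is concentrated at scale `1/N` with `L₁` norm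
`O(1/N)`, while `f' = O(N^γ |sin x|^{γ-1})` and `f'' = O(N^γ |sin x|^{γ-2})`. Integration by parts
gives `b_n = O(min(1/N, N^γ |n|^{-1-γ}))` for `n ≠ 0`, whose sum is bounded independently of `N`
(`SingularBound.exists_fourier_expansion`, `exists_uniform_fourier_expansion`).

On the half-line the unshifted symbols involve only right translations, so they are multipliers
there as well, and the norm bounds are inherited from `L₁(ℝ)` through extension by zero. -/

/-! ### The algebra of multipliers -/

/-- The Fourier transform at the frequency `k`, as a bounded linear functional. -/
def fourierCLM (μ : Measure ℝ) (k : ℝ) : L1 μ →L[ℂ] ℂ :=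
  LinearMap.mkContinuous
    { toFun := fun f => fourierL1 f k
      map_add' := fun f g => fourierL1_add f g k
      map_smul' := fun c f => fourierL1_smul c f k } 1
    fun f => by rw [one_mul]; exact norm_fourierL1_le f k

theorem fourierCLM_apply {μ : Measure ℝ} (k : ℝ) (f : L1 μ) :
    fourierCLM μ k f = fourierL1 f k := rfl

/-- The bounded operator `S` acts on Fourier transforms as multiplication by `ψ`. -/
def HasSymbol {μ : Measure ℝ} (S : L1 μ →L[ℂ] L1 μ) (ψ : ℝ → ℂ) : Prop :=
  ∀ (f : L1 μ) (k : ℝ), fourierL1 (S f) k = ψ k * fourierL1 f k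

section algebra

variable {μ : Measure ℝ}

theorem HasSymbol.isL1Multiplier {S : L1 μ →L[ℂ] L1 μ} {ψ : ℝ → ℂ} (hS : HasSymbol S ψ)
    (hψ : Measurable ψ) : IsL1Multiplier μ ψ :=
  ⟨hψ, fun f => ⟨S f, fun k => (hS f k).symm⟩⟩

theorem hasSymbol_multiplierOp [SigmaFinite μ] {ψ : ℝ → ℂ} (h : IsL1Multiplier μ ψ) :
    HasSymbol (multiplierOp μ ψ) ψ :=
  fourierL1_multiplierOp h

theorem HasSymbol.unique [SigmaFinite μ] {S S' : L1 μ →L[ℂ] L1 μ} {ψ : ℝ → ℂ}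
    (hS : HasSymbol S ψ) (hS' : HasSymbol S' ψ) : S = S' := by
  ext1 f
  exact fourierL1_injective fun k => by rw [hS, hS']

theorem HasSymbol.multiplierOp_eq [SigmaFinite μ] {S : L1 μ →L[ℂ] L1 μ} {ψ : ℝ → ℂ}
    (hS : HasSymbol S ψ) (hψ : Measurable ψ) : multiplierOp μ ψ = S :=
  (hasSymbol_multiplierOp (hS.isL1Multiplier hψ)).unique hS

theorem HasSymbol.smul {S : L1 μ →L[ℂ] L1 μ} {ψ : ℝ → ℂ} (c : ℂ) (hS : HasSymbol S ψ) :
    HasSymbol (c • S) fun k => c * ψ k := fun f k => by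
  rw [_root_.smul_apply, fourierL1_smul, hS, mul_assoc]

theorem IsL1Multiplier.mul {ψ ψ' : ℝ → ℂ} (h : IsL1Multiplier μ ψ) (h' : IsL1Multiplier μ ψ') :
    IsL1Multiplier μ fun k => ψ k * ψ' k := by
  refine ⟨h.1.mul h'.1, fun f => ?_⟩
  obtain ⟨v, hv⟩ := h'.2 f
  obtain ⟨w, hw⟩ := h.2 v
  exact ⟨w, fun k => by rw [mul_assoc, hv, hw]⟩

theorem IsL1Multiplier.add {ψ ψ' : ℝ → ℂ} (h : IsL1Multiplier μ ψ) (h' : IsL1Multiplier μ ψ') :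
    IsL1Multiplier μ fun k => ψ k + ψ' k := by
  refine ⟨h.1.add h'.1, fun f => ?_⟩
  obtain ⟨v, hv⟩ := h.2 f
  obtain ⟨w, hw⟩ := h'.2 f
  exact ⟨v + w, fun k => by rw [add_mul, hv, hw, fourierL1_add]⟩

theorem isL1Multiplier_const (c : ℂ) : IsL1Multiplier μ fun _ => c :=
  ⟨measurable_const, fun f => ⟨c • f, fun k => (fourierL1_smul c f k).symm⟩⟩

/-- Evaluating the transform at `k` is a bounded functional, so it passes through the exponential
series term by term and turns each `S ^ n` into `ψ k ^ n`. -/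
theorem HasSymbol.exp {S : L1 μ →L[ℂ] L1 μ} {ψ : ℝ → ℂ} (hS : HasSymbol S ψ) :
    HasSymbol (NormedSpace.exp S) fun k => Complex.exp (ψ k) := by
  intro f k
  have hpow : ∀ n : ℕ, fourierL1 ((S ^ n) f) k = ψ k ^ n * fourierL1 f k := by
    intro n
    induction n with
    | zero => simp
    | succ n ih => rw [pow_succ', mul_apply_eq_comp, hS, ih]; ring
  have h1 := (NormedSpace.exp_series_hasSum_exp' (𝕂 := ℂ) S).mapL
    ((fourierCLM μ k).comp (ContinuousLinearMap.apply ℂ (L1 μ) f))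
  have h2 := (NormedSpace.exp_series_hasSum_exp' (𝕂 := ℂ) (ψ k)).mul_right (fourierL1 f k)
  rw [Complex.exp_eq_exp_ℂ]
  have h3 : (fun n : ℕ => ((fourierCLM μ k).comp (ContinuousLinearMap.apply ℂ (L1 μ) f))
      (((n.factorial : ℂ))⁻¹ • S ^ n)) =
      fun n : ℕ => ((n.factorial : ℂ)⁻¹ • ψ k ^ n) * fourierL1 f k := by
    funext n
    simp [fourierCLM_apply, mul_assoc]
    exact Or.inl (by simpa using hpow n)
  rw [h3] at h1
  exact h1.unique h2

theorem multiplierOp_exp [SigmaFinite μ] {φ : ℝ → ℂ} (h : IsL1Multiplier μ φ) (t : ℝ) :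
    IsL1Multiplier μ (fun k => Complex.exp (t * φ k)) ∧
      multiplierOp μ (fun k => Complex.exp (t * φ k)) =
        NormedSpace.exp ((t : ℂ) • multiplierOp μ φ) := by
  have hs := ((hasSymbol_multiplierOp h).smul (t : ℂ)).exp
  have hm : Measurable fun k => Complex.exp (t * φ k) :=
    Complex.measurable_exp.comp (h.1.const_mul _)
  exact ⟨hs.isL1Multiplier hm, hs.multiplierOp_eq hm⟩

/-- Every multiplier generates a (uniformly continuous) semigroup of multiplier operators. -/
theorem generateSemigroups_of_isL1Multiplier [SigmaFinite μ] {φ : ℝ → ℝ → ℂ}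
    (hφ : ∀ h, 0 < h → IsL1Multiplier μ (φ h)) : GenerateSemigroups μ φ := by
  intro h hh
  have hT : (fun t : ℝ => multiplierOp μ fun k => Complex.exp (t * φ h k)) =
      fun t : ℝ => NormedSpace.exp ((t : ℂ) • multiplierOp μ (φ h)) :=
    funext fun t => (multiplierOp_exp (hφ h hh) t).2
  refine ⟨hφ h hh, fun t _ => (multiplierOp_exp (hφ h hh) t).1, ?_, ?_⟩
  · rw [hT]
    refine ⟨by simp [ContinuousLinearMap.one_def], fun s t _ _ => ?_, fun x => ?_⟩
    · rw [← ContinuousLinearMap.mul_def, Complex.ofReal_add, add_smul]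
      let _ : NormedAlgebra ℚ (L1 μ →L[ℂ] L1 μ) := NormedAlgebra.restrictScalars ℚ ℂ _
      exact NormedSpace.exp_add_of_commute
        (((Commute.refl _).smul_left _).smul_right _)
    · have hc : Continuous fun z : ℂ => NormedSpace.exp (z • multiplierOp μ (φ h)) :=
        continuous_iff_continuousAt.2 fun z =>
          (hasDerivAt_exp_smul_const (𝕂 := ℂ) (multiplierOp μ (φ h)) z).continuousAt
      exact ((hc.comp Complex.continuous_ofReal).clm_apply continuous_const).continuousOn
  · rw [hT]
    intro x
    have hd := hasDerivAt_exp_smul_const (𝕂 := ℂ) (multiplierOp μ (φ h)) (0 : ℂ)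
    rw [zero_smul, NormedSpace.exp_zero, one_mul] at hd
    have hd' : HasDerivAt (fun z : ℂ => NormedSpace.exp (z • multiplierOp μ (φ h)) x)
        (multiplierOp μ (φ h) x) (0 : ℝ) := by
      simpa using hd.clm_apply (hasDerivAt_const (0 : ℂ) x)
    have := (hd'.scomp (0 : ℝ) Complex.ofRealCLM.hasDerivAt).tendsto_slope_zero_right
    simp only [zero_add, zero_smul, NormedSpace.exp_zero, Complex.ofReal_zero, Function.comp_apply,
      Complex.ofRealCLM_apply, Complex.ofReal_one, one_smul] at this
    refine this.congr fun t => ?_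
    rw [← Complex.ofReal_inv, Complex.coe_smul]; rfl

end algebra

/-! ### Translations, and extension by zero from the half-line -/

theorem memLp_indicator_halfLine (f : L1 halfLine) :
    MemLp (indicator (Ici (0 : ℝ)) f) 1 volume :=
  (memLp_indicator_iff_restrict measurableSet_Ici).2 (Lp.memLp f)

theorem norm_toLp_indicator_halfLine (f : L1 halfLine) :
    ‖(memLp_indicator_halfLine f).toLp _‖ = ‖f‖ := by
  rw [Lp.norm_toLp, eLpNorm_indicator_eq_eLpNorm_restrict measurableSet_Ici, Lp.norm_def]

/-- Extension by zero, `L₁(ℝ₊) → L₁(ℝ)`. -/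
def extendZero : L1 halfLine →L[ℂ] L1 volume :=
  LinearMap.mkContinuous
    { toFun := fun f => (memLp_indicator_halfLine f).toLp _
      map_add' := fun f g => by
        rw [← MemLp.toLp_add]
        refine MemLp.toLp_congr _ _ ?_
        have h := (ae_restrict_iff' measurableSet_Ici).1 (Lp.coeFn_add f g)
        filter_upwards [h] with x hx
        by_cases hx0 : x ∈ Ici (0 : ℝ)
        · rw [Pi.add_apply]
          simp only [indicator_of_mem hx0, hx hx0, Pi.add_apply]
        · simp [indicator_of_notMem hx0]
      map_smul' := fun c f => by
        rw [RingHom.id_apply, ← MemLp.toLp_const_smul]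
        refine MemLp.toLp_congr _ _ ?_
        have h := (ae_restrict_iff' measurableSet_Ici).1 (Lp.coeFn_smul c f)
        filter_upwards [h] with x hx
        by_cases hx0 : x ∈ Ici (0 : ℝ)
        · rw [Pi.smul_apply]
          simp only [indicator_of_mem hx0, hx hx0, Pi.smul_apply]
        · simp [indicator_of_notMem hx0] } 1
    fun f => ((norm_toLp_indicator_halfLine f).trans (one_mul _).symm).le

theorem coeFn_extendZero (f : L1 halfLine) :
    extendZero f =ᵐ[volume] indicator (Ici (0 : ℝ)) f :=
  MemLp.coeFn_toLp (memLp_indicator_halfLine f)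

theorem norm_extendZero (f : L1 halfLine) : ‖extendZero f‖ = ‖f‖ :=
  norm_toLp_indicator_halfLine f

theorem fourierL1_extendZero (f : L1 halfLine) (k : ℝ) :
    fourierL1 (extendZero f) k = fourierL1 f k := by
  unfold fourierL1
  rw [← integral_indicator measurableSet_Ici]
  refine integral_congr_ae ?_
  filter_upwards [coeFn_extendZero f] with x hx
  rw [hx, indicator_mul_right]

theorem fourierL1_restrict_of_ae_eq_zero {g : L1 volume}
    (hg : ∀ᵐ x : ℝ, x ∉ Ici (0 : ℝ) → g x = 0) (k : ℝ) :
    fourierL1 (LpToLpRestrictCLM ℝ ℂ ℂ volume 1 (Ici (0 : ℝ)) g) k = fourierL1 g k := by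
  unfold fourierL1
  rw [← setIntegral_eq_integral_of_ae_compl_eq_zero (s := Ici (0 : ℝ))
    (f := fun x : ℝ => Complex.exp (Complex.I * k * x) * g x) (μ := volume)]
  · refine integral_congr_ae ?_
    filter_upwards [LpToLpRestrictCLM_coeFn ℂ (Ici (0 : ℝ)) g] with x hx
    rw [hx]
  · filter_upwards [hg] with x hx hx0
    rw [hx hx0, mul_zero]

/-- Translation by `c` on `L₁(ℝ)`. -/
def translate (c : ℝ) : L1 volume →L[ℂ] L1 volume :=
  (Lp.compMeasurePreservingₗᵢ ℂ (fun x : ℝ => x - c)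
    (measurePreserving_sub_right volume c)).toContinuousLinearMap

theorem coeFn_translate (c : ℝ) (f : L1 volume) :
    translate c f =ᵐ[volume] fun x => f (x - c) :=
  Lp.coeFn_compMeasurePreserving f (measurePreserving_sub_right volume c)

theorem norm_translate_le (c : ℝ) : ‖translate c‖ ≤ 1 :=
  LinearIsometry.norm_toContinuousLinearMap_le _

theorem hasSymbol_translate (c : ℝ) :
    HasSymbol (translate c) fun k => Complex.exp (Complex.I * k * c) := by
  intro f k
  unfold fourierL1
  rw [← integral_const_mul, ← integral_sub_right_eq_self
    (fun x : ℝ => Complex.exp (Complex.I * k * c) * (Complex.exp (Complex.I * k * x) * f x)) c]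
  refine integral_congr_ae ?_
  filter_upwards [coeFn_translate c f] with x hx
  rw [hx, ← mul_assoc, ← Complex.exp_add]
  congr 2
  push_cast; ring

/-- Translation by `c ≥ 0` on `L₁(ℝ₊)`. -/
def translateHalf (c : ℝ) : L1 halfLine →L[ℂ] L1 halfLine :=
  (LpToLpRestrictCLM ℝ ℂ ℂ volume 1 (Ici (0 : ℝ))).comp ((translate c).comp extendZero)

theorem norm_translateHalf_le (c : ℝ) : ‖translateHalf c‖ ≤ 1 := by
  refine ContinuousLinearMap.opNorm_le_bound _ zero_le_one fun f => ?_
  rw [one_mul]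
  refine (norm_Lp_toLp_restrict_le (Ici (0 : ℝ)) (translate c (extendZero f))).trans ?_
  refine ((translate c).le_of_opNorm_le (norm_translate_le c) _).trans ?_
  rw [one_mul, norm_extendZero]

theorem hasSymbol_translateHalf {c : ℝ} (hc : 0 ≤ c) :
    HasSymbol (translateHalf c) fun k => Complex.exp (Complex.I * k * c) := by
  intro f k
  -- The sign of `c` matters here: a shift to the right keeps the support in `[0, ∞)`, so
  -- restricting afterwards discards nothing.
  have h0 : ∀ᵐ x : ℝ, x ∉ Ici (0 : ℝ) → translate c (extendZero f) x = 0 := by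
    have h := (measurePreserving_sub_right (volume : Measure ℝ) c).quasiMeasurePreserving.ae
      (coeFn_extendZero f)
    filter_upwards [coeFn_translate c (extendZero f), h] with x hx hx' hx0
    rw [hx, hx', indicator_of_notMem]
    simp only [mem_Ici, not_le] at hx0 ⊢
    linarith
  calc fourierL1 (translateHalf c f) k = fourierL1 (translate c (extendZero f)) k :=
        fourierL1_restrict_of_ae_eq_zero h0 k
    _ = _ := by rw [hasSymbol_translate, fourierL1_extendZero]

/-- An absolutely convergent sum of contractions has as symbol the sum of the symbols. -/
theorem hasSymbol_tsum {μ : Measure ℝ} {ι : Type*} {S : ι → L1 μ →L[ℂ] L1 μ}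
    {χ : ι → ℝ → ℂ} (hS : ∀ i, HasSymbol (S i) (χ i)) (hS1 : ∀ i, ‖S i‖ ≤ 1) {b : ι → ℂ}
    (hb : Summable fun i => ‖b i‖) {ψ : ℝ → ℂ} (hψ : ∀ k, HasSum (fun i => b i * χ i k) (ψ k)) :
    HasSymbol (∑' i, b i • S i) ψ ∧ ‖∑' i, b i • S i‖ ≤ ∑' i, ‖b i‖ := by
  have hle : ∀ i, ‖b i • S i‖ ≤ ‖b i‖ := fun i => by
    rw [norm_smul]
    exact mul_le_of_le_one_right (norm_nonneg _) (hS1 i)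
  have hsum : Summable fun i => b i • S i := hb.of_norm_bounded hle
  refine ⟨fun f k => ?_, tsum_of_norm_bounded hb.hasSum hle⟩
  have h1 := hsum.hasSum.mapL
    ((fourierCLM μ k).comp (ContinuousLinearMap.apply ℂ (L1 μ) f))
  have h2 := (hψ k).mul_right (fourierL1 f k)
  have h3 : (fun i => ((fourierCLM μ k).comp (ContinuousLinearMap.apply ℂ (L1 μ) f))
      (b i • S i)) = fun i => b i * χ i k * fourierL1 f k := by
    funext i
    simp [fourierCLM_apply, hS i f k, mul_assoc]
  rw [h3] at h1
  exact h1.unique h2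

/-- The norm of a multiplier on `L₁(ℝ₊)` is at most its norm on `L₁(ℝ)`. -/
theorem norm_multiplierOp_halfLine_le {ψ : ℝ → ℂ} (h : IsL1Multiplier halfLine ψ)
    (h' : IsL1Multiplier volume ψ) :
    ‖multiplierOp halfLine ψ‖ ≤ ‖multiplierOp volume ψ‖ := by
  refine ContinuousLinearMap.opNorm_le_bound _ (norm_nonneg _) fun f => ?_
  -- Extension by zero preserves the norm and, by uniqueness of Fourier transforms, intertwines the
  -- two operators.
  have key : extendZero (multiplierOp halfLine ψ f) = multiplierOp volume ψ (extendZero f) :=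
    fourierL1_injective fun k => by
      rw [fourierL1_extendZero, fourierL1_multiplierOp h, fourierL1_multiplierOp h',
        fourierL1_extendZero]
  rw [← norm_extendZero, key]
  exact ((multiplierOp volume ψ).le_opNorm _).trans_eq (by rw [norm_extendZero])

/-! ### The binomial series on the closed unit disc -/

/-- On the closed disc `Re (1 - z) ≥ 0`, so the branch cut is met only at `0`, where a positive
power is still continuous. -/
theorem continuousAt_one_sub_cpow {α : ℝ} (hα : 0 < α) {z : ℂ} (hz : ‖z‖ ≤ 1) :
    ContinuousAt (fun w : ℂ => (1 - w) ^ (α : ℂ)) z := by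
  have h : ContinuousAt (fun w : ℂ => w ^ (α : ℂ)) (1 - z) := by
    refine Complex.continuousAt_cpow_const_of_re_pos (Or.inl ?_) (by simpa using hα)
    have := (Complex.re_le_norm z).trans hz
    simpa using this
  exact h.comp (f := fun w : ℂ => 1 - w) (by fun_prop)

theorem hasSum_choose_mul_pow (α : ℝ) {z : ℂ} (hz : ‖z‖ < 1) :
    HasSum (fun n : ℕ => (((-1) ^ n * Ring.choose α n : ℝ) : ℂ) * z ^ n)
      ((1 - z) ^ (α : ℂ)) := by
  have h := (Complex.one_add_cpow_hasFPowerSeriesOnBall_zero (a := (α : ℂ))).hasSum (y := -z)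
    (by rw [← ENNReal.ofReal_one, Metric.eball_ofReal]; simpa using hz)
  rw [zero_add, ← sub_eq_add_neg] at h
  have e : (fun n : ℕ => (((-1) ^ n * Ring.choose α n : ℝ) : ℂ) * z ^ n) =
      fun n : ℕ => (binomialSeries ℂ (α : ℂ) n) fun _ => -z := by
    funext n
    rw [binomialSeries_apply, List.prod_ofFn, Fin.prod_const, Complex.ofReal_mul,
      Complex.ofReal_choose, smul_eq_mul, neg_pow z n]
    push_cast; ring
  rw [e]; exact h

/-- The signed coefficients satisfy `(m + 1) c_{m+1} = (m - α) c_m`; the first factor `-α` makes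
`c_1` negative, and all later factors are positive. -/
theorem neg_one_pow_mul_choose_nonpos {α : ℝ} (h0 : 0 < α) (h1 : α < 1) (n : ℕ) :
    (-1) ^ (n + 1) * Ring.choose α (n + 1) ≤ 0 := by
  have hrec : ∀ m : ℕ, ((m : ℝ) + 1) * Ring.choose α (m + 1) = Ring.choose α m * (α - m) := by
    intro m
    have e1 := Ring.descPochhammer_eq_factorial_smul_choose α (m + 1)
    have e2 := Ring.descPochhammer_eq_factorial_smul_choose α m
    rw [descPochhammer_succ_right, Polynomial.smeval_mul, e2] at e1
    simp only [Polynomial.smeval_sub, Polynomial.smeval_X, pow_one, Polynomial.smeval_natCast,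
      pow_zero, nsmul_eq_mul, mul_one, Nat.factorial_succ, Nat.cast_mul] at e1
    have hf : (m.factorial : ℝ) ≠ 0 := by positivity
    apply mul_left_cancel₀ hf
    push_cast at e1
    linarith
  induction n with
  | zero =>
    have := hrec 0
    simp at this
    simp [h0.le]
  | succ n ih =>
    have h := hrec (n + 1)
    push_cast at h
    have hn : (0 : ℝ) < (n : ℝ) + 1 + 1 := by positivity
    refine nonpos_of_mul_nonpos_right (a := (n : ℝ) + 1 + 1) ?_ hn
    have e : ((n : ℝ) + 1 + 1) * ((-1) ^ (n + 1 + 1) * Ring.choose α (n + 1 + 1)) =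
        ((n : ℝ) + 1 - α) * ((-1) ^ (n + 1) * Ring.choose α (n + 1)) := by
      rw [mul_left_comm, h]; ring
    rw [e]
    exact mul_nonpos_of_nonneg_of_nonpos (by linarith [(Nat.cast_nonneg n : (0 : ℝ) ≤ n)]) ih

/-- Beyond the constant term all coefficients have one sign, so for `0 < x < 1` their absolute
values weighted by powers of `x` have partial sums at most `1 - (1 - x)^α ≤ 1`; let `x → 1` in each
finite sum. -/
theorem summable_choose {α : ℝ} (h0 : 0 < α) (h1 : α < 1) :
    Summable fun n : ℕ => ‖(((-1) ^ n * Ring.choose α n : ℝ) : ℂ)‖ := by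
  simp only [Complex.norm_real]
  rw [← summable_nat_add_iff 1]
  have hneg : ∀ n : ℕ, ‖(-1) ^ (n + 1) * Ring.choose α (n + 1)‖ =
      -((-1) ^ (n + 1) * Ring.choose α (n + 1)) := fun n => by
    rw [Real.norm_of_nonpos (neg_one_pow_mul_choose_nonpos h0 h1 n)]
  refine summable_of_sum_range_le (c := 1) (fun n => norm_nonneg _) fun M => ?_
  simp only [hneg]
  have hlim : Tendsto (fun x : ℝ => ∑ n ∈ Finset.range M,
      -((-1) ^ (n + 1) * Ring.choose α (n + 1)) * x ^ (n + 1)) (𝓝[<] 1)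
      (𝓝 (∑ n ∈ Finset.range M, -((-1) ^ (n + 1) * Ring.choose α (n + 1)))) := by
    have hc : Continuous fun x : ℝ => ∑ n ∈ Finset.range M,
      -((-1) ^ (n + 1) * Ring.choose α (n + 1)) * x ^ (n + 1) := by fun_prop
    simpa using (hc.tendsto 1).mono_left nhdsWithin_le_nhds
  refine le_of_tendsto hlim ?_
  filter_upwards [Ioo_mem_nhdsLT (show (0 : ℝ) < 1 by norm_num)] with x hx
  have hs := hasSum_choose_mul_pow α (z := (x : ℂ)) (by
    rw [Complex.norm_real, Real.norm_of_nonneg hx.1.le]; exact hx.2)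
  have e : ((1 : ℂ) - x) ^ (α : ℂ) = (((1 - x) ^ α : ℝ) : ℂ) := by
    rw [Complex.ofReal_cpow (by linarith [hx.2])]; push_cast; rfl
  rw [e] at hs
  have hs' : HasSum (fun n : ℕ => ((-1) ^ n * Ring.choose α n) * x ^ n) ((1 - x) ^ α) := by
    exact_mod_cast hs
  rw [← hasSum_nat_add_iff' 1] at hs'
  have hb := sum_le_hasSum (Finset.range M) (fun n _ => ?_) hs'.neg
  · simp only [Finset.range_one, Finset.sum_singleton, pow_zero, Ring.choose_zero_right,
      one_mul, neg_sub] at hb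
    simp only [neg_mul]
    have : 0 ≤ (1 - x) ^ α := Real.rpow_nonneg (by linarith [hx.2]) _
    linarith
  · rw [← neg_mul]
    exact mul_nonneg (neg_nonneg.2 (neg_one_pow_mul_choose_nonpos h0 h1 n)) (pow_nonneg hx.1.le _)

/-- Absolute summability makes the series continuous on the closed disc. It agrees with the power
inside, hence also at `z`, by following the ray `r z` as `r → 1`. -/
theorem hasSum_choose_mul_pow_of_norm_le {α : ℝ} (h0 : 0 < α) (h1 : α < 1) {z : ℂ}
    (hz : ‖z‖ ≤ 1) :
    HasSum (fun n : ℕ => (((-1) ^ n * Ring.choose α n : ℝ) : ℂ) * z ^ n)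
      ((1 - z) ^ (α : ℂ)) := by
  set c : ℕ → ℂ := fun n => (((-1) ^ n * Ring.choose α n : ℝ) : ℂ) with hc
  have hsum := summable_choose h0 h1
  have hle : ∀ n (w : ℂ), w ∈ Metric.closedBall (0 : ℂ) 1 → ‖c n * w ^ n‖ ≤ ‖c n‖ := by
    intro n w hw
    rw [norm_mul, norm_pow]
    refine mul_le_of_le_one_right (norm_nonneg _) (pow_le_one₀ (norm_nonneg _) ?_)
    simpa using hw
  have hcont : ContinuousOn (fun w : ℂ => ∑' n, c n * w ^ n) (Metric.closedBall 0 1) :=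
    continuousOn_tsum (fun n => by fun_prop) hsum hle
  have hz' : z ∈ Metric.closedBall (0 : ℂ) 1 := by simpa using hz
  have hs : Summable fun n => c n * z ^ n := hsum.of_norm_bounded fun n => hle n z hz'
  have hray : Tendsto (fun r : ℝ => (r : ℂ) * z) (𝓝[<] 1) (𝓝 z) := by
    have : Continuous fun r : ℝ => (r : ℂ) * z := by fun_prop
    simpa using (this.tendsto 1).mono_left nhdsWithin_le_nhds
  have hball : ∀ᶠ r : ℝ in 𝓝[<] 1, ‖(r : ℂ) * z‖ < 1 := by
    filter_upwards [Ioo_mem_nhdsLT (show (0 : ℝ) < 1 by norm_num)] with r hr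
    rw [norm_mul, Complex.norm_real, Real.norm_of_nonneg hr.1.le]
    exact (mul_le_of_le_one_right hr.1.le hz).trans_lt hr.2
  have l1 : Tendsto (fun r : ℝ => ∑' n, c n * ((r : ℂ) * z) ^ n) (𝓝[<] 1)
      (𝓝 (∑' n, c n * z ^ n)) :=
    (hcont z hz').tendsto.comp (tendsto_nhdsWithin_iff.2 ⟨hray, by
      filter_upwards [hball] with r hr using by simpa using hr.le⟩)
  have l2 := (continuousAt_one_sub_cpow h0 hz).tendsto.comp hray
  have := tendsto_nhds_unique (l1.congr' ?_) l2
  · rw [← this]; exact hs.hasSum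
  · filter_upwards [hball] with r hr
    exact (hasSum_choose_mul_pow α hr).tsum_eq

/-- `(1 - e^{ikh})^α` is a multiplier whenever the right translations act contractively. -/
theorem isL1Multiplier_one_sub_exp_cpow {μ : Measure ℝ}
    (hμ : ∀ c : ℝ, 0 ≤ c → ∃ S : L1 μ →L[ℂ] L1 μ, ‖S‖ ≤ 1 ∧
      HasSymbol S fun k => Complex.exp (Complex.I * k * c))
    {α : ℝ} (h0 : 0 < α) (h1 : α < 1) {h : ℝ} (hh : 0 ≤ h) :
    IsL1Multiplier μ fun k => (1 - Complex.exp (Complex.I * k * h)) ^ (α : ℂ) := by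
  choose S hS1 hS using fun n : ℕ => hμ (n * h) (by positivity)
  refine (hasSymbol_tsum hS hS1 (summable_choose h0 h1) fun k => ?_).1.isL1Multiplier
    (by fun_prop)
  have hk : ‖Complex.exp (Complex.I * k * h)‖ ≤ 1 := by
    have : Complex.I * k * h = ((k * h : ℝ) : ℂ) * Complex.I := by push_cast; ring
    rw [this, Complex.norm_exp_ofReal_mul_I]
  have := hasSum_choose_mul_pow_of_norm_le h0 h1 hk
  simp only [← Complex.exp_nat_mul] at this
  convert! this using 4 with n
  push_cast; ring

/-! ### Fourier coefficients of functions with algebraic singularities -/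

/-- The constant in the decay estimate for oscillatory integrals. -/
def oscConst (γ : ℝ) : ℝ := 1 / γ + 2 + 1 / (1 - γ)

theorem norm_exp_I_mul (l x : ℝ) : ‖Complex.exp (Complex.I * l * x)‖ = 1 := by
  have : Complex.I * l * x = ((l * x : ℝ) : ℂ) * Complex.I := by push_cast; ring
  rw [this, Complex.norm_exp_ofReal_mul_I]

theorem hasDerivAt_inv_mul_exp_I {l : ℝ} (hl : Complex.I * (l : ℂ) ≠ 0) (x : ℝ) :
    HasDerivAt (fun x : ℝ => (Complex.I * (l : ℂ))⁻¹ * Complex.exp (Complex.I * l * x))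
      (Complex.exp (Complex.I * l * x)) x := by
  have h := ((((hasDerivAt_id x).ofReal_comp).const_mul (Complex.I * (l : ℂ))).cexp).const_mul
    (Complex.I * (l : ℂ))⁻¹
  refine h.congr_deriv ?_
  simp only [id, Complex.ofReal_one, mul_one]
  rw [mul_comm (Complex.exp _), inv_mul_cancel_left₀ hl]

theorem intervalIntegrable_of_norm_le_rpow {γ D : ℝ} (hγ : 0 < γ) {u : ℝ → ℂ} (hu : Measurable u)
    {b : ℝ} (hb : 0 ≤ b) (h : ∀ x ∈ Ioc 0 b, ‖u x‖ ≤ D * x ^ (γ - 1)) :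
    IntervalIntegrable u volume 0 b := by
  refine ((intervalIntegral.intervalIntegrable_rpow' (a := 0) (b := b)
    (show -1 < γ - 1 by linarith)).const_mul D).mono_fun' hu.aestronglyMeasurable ?_
  rw [uIoc_of_le hb]
  exact (ae_restrict_iff' measurableSet_Ioc).2 (Eventually.of_forall h)

/-- An oscillatory integral with an algebraic singularity at the origin: cut at `1/|l|` and
integrate by parts. -/
theorem norm_integral_osc_le {γ D : ℝ} (h0 : 0 < γ) (h1 : γ < 1) {u u' : ℝ → ℂ} {b : ℝ}
    (hb : 1 ≤ b) (hu : Measurable u) (hu' : Measurable u')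
    (hd : ∀ x ∈ Ioc 0 b, HasDerivAt u (u' x) x)
    (hle : ∀ x ∈ Ioc 0 b, ‖u x‖ ≤ D * x ^ (γ - 1))
    (hle' : ∀ x ∈ Ioc 0 b, ‖u' x‖ ≤ D * x ^ (γ - 2)) {l : ℝ} (hl : 1 ≤ |l|) :
    ‖∫ x in (0 : ℝ)..b, u x * Complex.exp (Complex.I * l * x)‖ ≤
      oscConst γ * D * |l| ^ (-γ) := by
  have hb0 : 0 < b := by linarith
  have hl0 : 0 < |l| := by linarith
  have hD : 0 ≤ D := by
    have := (norm_nonneg _).trans (hle 1 ⟨one_pos, hb⟩)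
    simpa using this
  set η : ℝ := |l|⁻¹ with hη
  have hη0 : 0 < η := inv_pos.2 hl0
  have hη1 : η ≤ 1 := inv_le_one_of_one_le₀ hl
  have hηb : η ≤ b := hη1.trans hb
  have hlγ : |l| ^ (-γ) = η ^ γ := by rw [hη, Real.inv_rpow hl0.le, Real.rpow_neg hl0.le]
  set e : ℝ → ℂ := fun x => Complex.exp (Complex.I * l * x) with he
  have hec : Continuous e := by fun_prop
  have hint : IntervalIntegrable (fun x => u x * e x) volume 0 b :=
    (intervalIntegrable_of_norm_le_rpow h0 hu hb0.le hle).mul_continuousOn hec.continuousOn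
  have hsub : (uIcc 0 η) ⊆ (uIcc 0 b) := by
    rw [uIcc_of_le hη0.le, uIcc_of_le hb0.le]; exact Icc_subset_Icc_right hηb
  have hsub' : (uIcc η b) ⊆ (uIcc 0 b) := by
    rw [uIcc_of_le hηb, uIcc_of_le hb0.le]; exact Icc_subset_Icc_left hη0.le
  rw [← intervalIntegral.integral_add_adjacent_intervals (hint.mono_set hsub)
    (hint.mono_set hsub')]
  -- the part near the singularity
  have i1 : ‖∫ x in (0 : ℝ)..η, u x * e x‖ ≤ D * (η ^ γ / γ) := by
    have : ∫ x in (0 : ℝ)..η, D * x ^ (γ - 1) = D * (η ^ γ / γ) := by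
      rw [intervalIntegral.integral_const_mul, integral_rpow (Or.inl (by linarith)),
        sub_add_cancel, Real.zero_rpow h0.ne', sub_zero]
    rw [← this]
    refine intervalIntegral.norm_integral_le_of_norm_le hη0.le (Eventually.of_forall fun x hx => ?_)
      ((intervalIntegral.intervalIntegrable_rpow' (by linarith)).const_mul D)
    rw [norm_mul, he, norm_exp_I_mul, mul_one]
    exact hle x ⟨hx.1, hx.2.trans hηb⟩
  -- integration by parts away from it
  have hl' : (l : ℂ) ≠ 0 := by exact_mod_cast abs_pos.1 hl0
  have hIl : Complex.I * (l : ℂ) ≠ 0 := mul_ne_zero Complex.I_ne_zero hl'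
  set v : ℝ → ℂ := fun x => (Complex.I * l)⁻¹ * e x with hv
  have hvn : ∀ x, ‖v x‖ = η := fun x => by
    rw [hv, norm_mul, he, norm_exp_I_mul, mul_one, norm_inv, norm_mul, Complex.norm_I, one_mul,
      Complex.norm_real, Real.norm_eq_abs]
  have hvd : ∀ x, HasDerivAt v (e x) x := fun x => hasDerivAt_inv_mul_exp_I hIl x
  have hpow : IntervalIntegrable (fun x : ℝ => D * x ^ (γ - 2)) volume η b :=
    (intervalIntegral.intervalIntegrable_rpow (Or.inr (by
      rw [uIcc_of_le hηb]; exact fun h => absurd h.1 (not_le.2 hη0)))).const_mul D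
  have hu'i : IntervalIntegrable u' volume η b := by
    refine hpow.mono_fun' hu'.aestronglyMeasurable ?_
    rw [uIoc_of_le hηb]
    exact (ae_restrict_iff' measurableSet_Ioc).2
      (Eventually.of_forall fun x hx => hle' x ⟨hη0.trans hx.1, hx.2⟩)
  have hparts := intervalIntegral.integral_mul_deriv_eq_deriv_mul (a := η) (b := b) (u := u)
    (v := v) (u' := u') (v' := e)
    (fun x hx => by
      rw [uIcc_of_le hηb] at hx
      exact hd x ⟨hη0.trans_le hx.1, hx.2⟩) (fun x _ => hvd x) hu'i
    (hec.intervalIntegrable _ _)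
  have j1 : ‖u b * v b‖ ≤ D * η ^ γ := by
    rw [norm_mul, hvn]
    have a1 : b ^ (γ - 1) ≤ 1 := Real.rpow_le_one_of_one_le_of_nonpos hb (by linarith)
    have a2 : η ≤ η ^ γ := by
      simpa using Real.rpow_le_rpow_of_exponent_ge hη0 hη1 h1.le
    have a3 := hle b ⟨hb0, le_rfl⟩
    have a4 : ‖u b‖ ≤ D := a3.trans (mul_le_of_le_one_right hD a1)
    exact mul_le_mul a4 a2 hη0.le hD
  have hηγ : η ^ (γ - 1) * η = η ^ γ := by
    rw [← Real.rpow_add_one hη0.ne', sub_add_cancel]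
  have j2 : ‖u η * v η‖ ≤ D * η ^ γ := by
    rw [norm_mul, hvn, ← hηγ, ← mul_assoc]
    exact mul_le_mul_of_nonneg_right (hle η ⟨hη0, hηb⟩) hη0.le
  have j3 : ‖∫ x in η..b, u' x * v x‖ ≤ D * (η ^ γ / (1 - γ)) := by
    have hval : ∫ x in η..b, D * x ^ (γ - 2) * η ≤ D * (η ^ γ / (1 - γ)) := by
      rw [intervalIntegral.integral_mul_const, intervalIntegral.integral_const_mul,
        integral_rpow (Or.inr ⟨by linarith, by
          rw [uIcc_of_le hηb]; exact fun h => absurd h.1 (not_le.2 hη0)⟩)]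
      have e1 : γ - 2 + 1 = γ - 1 := by ring
      rw [e1, ← hηγ, mul_assoc]
      refine mul_le_mul_of_nonneg_left ?_ hD
      rw [div_mul_eq_mul_div, ← neg_div_neg_eq, neg_sub]
      have h1' : 0 < 1 - γ := by linarith
      refine (div_le_div_iff_of_pos_right h1').2 ?_
      have := mul_nonneg (Real.rpow_nonneg hb0.le (γ - 1)) hη0.le
      nlinarith
    refine le_trans ?_ hval
    refine intervalIntegral.norm_integral_le_of_norm_le hηb (Eventually.of_forall fun x hx => ?_)
      (hpow.mul_const η)
    rw [norm_mul, hvn]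
    exact mul_le_mul_of_nonneg_right (hle' x ⟨hη0.trans hx.1, hx.2⟩) hη0.le
  have i2 : ‖∫ x in η..b, u x * e x‖ ≤ D * η ^ γ + D * η ^ γ + D * (η ^ γ / (1 - γ)) := by
    rw [hparts]
    exact (norm_sub_le _ _).trans (add_le_add ((norm_sub_le _ _).trans (add_le_add j1 j2)) j3)
  refine (norm_add_le _ _).trans ((add_le_add i1 i2).trans (le_of_eq ?_))
  -- The summands of `oscConst`: `1/γ` from the piece near the singularity, `2` from the boundary
  -- terms, `1/(1 - γ)` from the remaining integral of `u'`.
  rw [hlγ, oscConst]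
  ring

/-- Jordan's inequality gives `sin x ≥ (2/π) x ≥ x/2`, and `(1/2)^p ≤ 4` for `p ≥ -2`. -/
theorem rpow_abs_sin_le {p x : ℝ} (hp0 : p ≤ 0) (hp2 : -2 ≤ p) (hx : x ∈ Ioc 0 (Real.pi / 2)) :
    |Real.sin x| ^ p ≤ 4 * x ^ p := by
  have hpi := Real.pi_pos
  have h := Real.mul_le_sin hx.1.le hx.2
  have hpos : 0 < 2 / Real.pi * x := mul_pos (by positivity) hx.1
  rw [abs_of_pos (hpos.trans_le h)]
  refine (Real.rpow_le_rpow_of_nonpos hpos h hp0).trans ?_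
  rw [Real.mul_rpow (by positivity) hx.1.le]
  refine mul_le_mul_of_nonneg_right ?_ (Real.rpow_nonneg hx.1.le _)
  have h2 : (1 : ℝ) / 2 ≤ 2 / Real.pi := by
    rw [div_le_div_iff₀ two_pos hpi]; linarith [Real.pi_le_four]
  have e : (2 / Real.pi) ^ p ≤ (1 / 2 : ℝ) ^ p :=
    Real.rpow_le_rpow_of_nonpos (by norm_num) h2 hp0
  have e2 : (1 / 2 : ℝ) ^ p ≤ (1 / 2 : ℝ) ^ (-2 : ℝ) :=
    Real.rpow_le_rpow_of_exponent_ge (by norm_num) (by norm_num) hp2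
  refine e.trans (e2.trans (le_of_eq ?_))
  rw [Real.rpow_neg (by norm_num), Real.rpow_two]; norm_num

/-- A function on the circle that is smooth except for algebraic singularities at `0` and `π`. -/
structure SingularBound (γ D : ℝ) (f f₁ f₂ : ℝ → ℂ) : Prop where
  cont : Continuous f
  periodic : Function.Periodic f (2 * Real.pi)
  meas₁ : Measurable f₁
  meas₂ : Measurable f₂
  deriv₁ : ∀ x, Real.sin x ≠ 0 → HasDerivAt f (f₁ x) x
  deriv₂ : ∀ x, Real.sin x ≠ 0 → HasDerivAt f₁ (f₂ x) x
  le₁ : ∀ x, Real.sin x ≠ 0 → ‖f₁ x‖ ≤ D * |Real.sin x| ^ (γ - 1)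
  le₂ : ∀ x, Real.sin x ≠ 0 → ‖f₂ x‖ ≤ D * |Real.sin x| ^ (γ - 2)

theorem sin_ne_zero_of_mem_Ioc {x : ℝ} (hx : x ∈ Ioc 0 (Real.pi / 2)) : Real.sin x ≠ 0 :=
  (Real.sin_pos_of_pos_of_lt_pi hx.1 (by linarith [hx.2, Real.pi_pos])).ne'

namespace SingularBound

variable {γ D : ℝ} {f f₁ f₂ : ℝ → ℂ}

theorem nonneg (H : SingularBound γ D f f₁ f₂) : 0 ≤ D := by
  have h := (norm_nonneg _).trans (H.le₁ (Real.pi / 2) (by simp))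
  simpa using h

/-- Each quarter of the circle is parametrised from its singular endpoint `σ` in direction `ε = ±1`.
As `|sin|` is unchanged, `norm_integral_osc_le` applies with frequency `ε l`; the phase `e^{ilσ}`
has modulus one. -/
theorem norm_quarter_le (H : SingularBound γ D f f₁ f₂) (h0 : 0 < γ) (h1 : γ < 1) {σ ε : ℝ}
    (hε : |ε| = 1) (hσ : ∀ x, |Real.sin (σ + ε * x)| = |Real.sin x|) :
    IntervalIntegrable (fun x => f₁ (σ + ε * x)) volume 0 (Real.pi / 2) ∧
    ∀ l : ℝ, 1 ≤ |l| →
      ‖∫ x in (0 : ℝ)..(Real.pi / 2),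
          f₁ (σ + ε * x) * Complex.exp (Complex.I * l * (σ + ε * x : ℝ))‖
        ≤ oscConst γ * (4 * D) * |l| ^ (-γ) := by
  have hne : ∀ x ∈ Ioc 0 (Real.pi / 2), Real.sin (σ + ε * x) ≠ 0 := fun x hx h => by
    have := hσ x
    rw [h, abs_zero, eq_comm, abs_eq_zero] at this
    exact sin_ne_zero_of_mem_Ioc hx this
  have hle : ∀ x ∈ Ioc 0 (Real.pi / 2), ‖f₁ (σ + ε * x)‖ ≤ 4 * D * x ^ (γ - 1) := fun x hx => by
    have h := H.le₁ _ (hne x hx)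
    rw [hσ] at h
    refine h.trans ((mul_le_mul_of_nonneg_left
      (rpow_abs_sin_le (by linarith) (by linarith) hx) H.nonneg).trans_eq (by ring))
  have hm₁ : Measurable fun x => f₁ (σ + ε * x) := H.meas₁.comp (by fun_prop)
  have hm₂ : Measurable fun x => (ε : ℂ) * f₂ (σ + ε * x) :=
    (H.meas₂.comp (by fun_prop)).const_mul _
  have hpi2 : 1 ≤ Real.pi / 2 := by linarith [Real.two_le_pi]
  refine ⟨intervalIntegrable_of_norm_le_rpow h0 hm₁ (by linarith) hle, fun l hl => ?_⟩
  have key := norm_integral_osc_le (D := 4 * D) h0 h1 hpi2 hm₁ hm₂ (fun x hx => ?_) hle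
    (fun x hx => ?_) (l := ε * l) (by rwa [abs_mul, hε, one_mul])
  · rw [abs_mul, hε, one_mul] at key
    have e : ∀ x : ℝ, f₁ (σ + ε * x) * Complex.exp (Complex.I * l * (σ + ε * x : ℝ)) =
        Complex.exp (Complex.I * l * σ) *
          (f₁ (σ + ε * x) * Complex.exp (Complex.I * (ε * l : ℝ) * x)) := fun x => by
      rw [mul_left_comm, ← Complex.exp_add]
      congr 2
      push_cast; ring
    simp only [e]
    rw [intervalIntegral.integral_const_mul, norm_mul, norm_exp_I_mul, one_mul]
    exact key
  · have hin : HasDerivAt (fun x : ℝ => σ + ε * x) ε x := by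
      simpa using ((hasDerivAt_id x).const_mul ε).const_add σ
    simpa [Function.comp_def] using (H.deriv₂ _ (hne x hx)).scomp x hin
  · have h := H.le₂ _ (hne x hx)
    rw [hσ] at h
    rw [norm_mul, Complex.norm_real, Real.norm_eq_abs, hε, one_mul]
    refine h.trans ((mul_le_mul_of_nonneg_left
      (rpow_abs_sin_le (by linarith) (by linarith) hx) H.nonneg).trans_eq (by ring))

theorem norm_integral_deriv_le (H : SingularBound γ D f f₁ f₂) (h0 : 0 < γ) (h1 : γ < 1) :
    IntervalIntegrable f₁ volume (-Real.pi) 0 ∧ IntervalIntegrable f₁ volume 0 Real.pi ∧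
    ∀ l : ℝ, 1 ≤ |l| →
      ‖∫ x in (-Real.pi)..Real.pi, f₁ x * Complex.exp (Complex.I * l * x)‖
        ≤ 4 * (oscConst γ * (4 * D) * |l| ^ (-γ)) := by
  -- The quarters to the right and left of `0`, to the left of `π` and to the right of `-π`.
  have q1 := H.norm_quarter_le h0 h1 (σ := 0) (ε := 1) (by simp) (by simp)
  have q2 := H.norm_quarter_le h0 h1 (σ := 0) (ε := -1) (by simp) (by simp)
  have q3 := H.norm_quarter_le h0 h1 (σ := Real.pi) (ε := -1) (by simp) (fun x => by
    rw [neg_one_mul, ← sub_eq_add_neg, Real.sin_pi_sub])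
  have q4 := H.norm_quarter_le h0 h1 (σ := -Real.pi) (ε := 1) (by simp) (fun x => by
    rw [one_mul, neg_add_eq_sub, Real.sin_sub_pi, abs_neg])
  have s1 : ∀ g : ℝ → ℂ, ∫ x in (0 : ℝ)..(Real.pi / 2), g (0 + 1 * x) =
      ∫ x in (0 : ℝ)..(Real.pi / 2), g x := fun g => by simp
  have s2 : ∀ g : ℝ → ℂ, ∫ x in (0 : ℝ)..(Real.pi / 2), g (0 + -1 * x) =
      ∫ x in (-(Real.pi / 2))..0, g x := fun g => by simp
  have s3 : ∀ g : ℝ → ℂ, ∫ x in (0 : ℝ)..(Real.pi / 2), g (Real.pi + -1 * x) =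
      ∫ x in (Real.pi / 2)..Real.pi, g x := fun g => by
    simp only [neg_one_mul, ← sub_eq_add_neg]
    rw [intervalIntegral.integral_comp_sub_left (fun x => g x)]
    congr 1 <;> ring
  have s4 : ∀ g : ℝ → ℂ, ∫ x in (0 : ℝ)..(Real.pi / 2), g (-Real.pi + 1 * x) =
      ∫ x in (-Real.pi)..(-(Real.pi / 2)), g x := fun g => by
    simp only [one_mul]
    rw [intervalIntegral.integral_comp_add_left (fun x => g x)]
    congr 1 <;> ring
  have t1 : IntervalIntegrable f₁ volume 0 (Real.pi / 2) := by simpa using q1.1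
  have t2 : IntervalIntegrable f₁ volume (-(Real.pi / 2)) 0 := by
    have := q2.1
    simp only [zero_add, neg_one_mul] at this
    rw [IntervalIntegrable.iff_comp_neg]
    simpa using this.symm
  have t3 : IntervalIntegrable f₁ volume (Real.pi / 2) Real.pi := by
    have := q3.1
    simp only [neg_one_mul, ← sub_eq_add_neg] at this
    have := (this.comp_sub_left Real.pi).symm
    simp only [sub_sub_cancel, sub_zero] at this
    rwa [show Real.pi - Real.pi / 2 = Real.pi / 2 by ring] at this
  have t4 : IntervalIntegrable f₁ volume (-Real.pi) (-(Real.pi / 2)) := by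
    have := q4.1
    simp only [one_mul] at this
    have := this.comp_add_left Real.pi
    simp only [neg_add_cancel_left, zero_sub] at this
    rwa [show Real.pi / 2 - Real.pi = -(Real.pi / 2) by ring] at this
  refine ⟨t4.trans t2, t1.trans t3, fun l hl => ?_⟩
  have hec : ∀ a b : ℝ, ContinuousOn (fun x : ℝ => Complex.exp (Complex.I * l * x)) (uIcc a b) :=
    fun a b => by fun_prop
  have hsplit : ∫ x in (-Real.pi)..Real.pi, f₁ x * Complex.exp (Complex.I * l * x) =
      (((∫ x in (-Real.pi)..(-(Real.pi / 2)), f₁ x * Complex.exp (Complex.I * l * x)) +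
      ∫ x in (-(Real.pi / 2))..0, f₁ x * Complex.exp (Complex.I * l * x)) +
      ∫ x in (0 : ℝ)..(Real.pi / 2), f₁ x * Complex.exp (Complex.I * l * x)) +
      ∫ x in (Real.pi / 2)..Real.pi, f₁ x * Complex.exp (Complex.I * l * x) := by
    rw [intervalIntegral.integral_add_adjacent_intervals (t4.mul_continuousOn (hec _ _))
        (t2.mul_continuousOn (hec _ _)),
      intervalIntegral.integral_add_adjacent_intervals ((t4.trans t2).mul_continuousOn (hec _ _))
        (t1.mul_continuousOn (hec _ _)),
      intervalIntegral.integral_add_adjacent_intervals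
        (((t4.trans t2).trans t1).mul_continuousOn (hec _ _)) (t3.mul_continuousOn (hec _ _))]
  have b1 := q1.2 l hl
  have b2 := q2.2 l hl
  have b3 := q3.2 l hl
  have b4 := q4.2 l hl
  rw [s1 fun x => f₁ x * Complex.exp (Complex.I * l * x)] at b1
  rw [s2 fun x => f₁ x * Complex.exp (Complex.I * l * x)] at b2
  rw [s3 fun x => f₁ x * Complex.exp (Complex.I * l * x)] at b3
  rw [s4 fun x => f₁ x * Complex.exp (Complex.I * l * x)] at b4
  rw [hsplit]
  refine (norm_add₄_le).trans ?_
  linarith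

/-- Decay of the Fourier coefficients. -/
theorem norm_integral_le (H : SingularBound γ D f f₁ f₂) (h0 : 0 < γ) (h1 : γ < 1) {n : ℤ}
    (hn : n ≠ 0) :
    ‖∫ x in (-Real.pi)..Real.pi, f x * Complex.exp (Complex.I * (n : ℝ) * x)‖ ≤
      16 * oscConst γ * D * |(n : ℝ)| ^ (-1 - γ) := by
  obtain ⟨t1, t2, hbound⟩ := H.norm_integral_deriv_le h0 h1
  have hpi := Real.pi_pos
  have hn1 : (1 : ℝ) ≤ |(n : ℝ)| := by exact_mod_cast Int.one_le_abs hn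
  have hn0 : 0 < |(n : ℝ)| := by linarith
  set e : ℝ → ℂ := fun x => Complex.exp (Complex.I * (n : ℝ) * x) with he
  have hec : Continuous e := by fun_prop
  have hIl : Complex.I * ((n : ℝ) : ℂ) ≠ 0 :=
    mul_ne_zero Complex.I_ne_zero (by exact_mod_cast hn)
  set v : ℝ → ℂ := fun x => (Complex.I * (n : ℝ))⁻¹ * e x with hv
  have hvc : Continuous v := by fun_prop
  have hvd : ∀ x, HasDerivAt v (e x) x := fun x => hasDerivAt_inv_mul_exp_I hIl x
  -- Differentiability may fail at `0` and `±π`, so parts is done on each half separately. The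
  -- boundary terms at `0` cancel between the halves, those at `±π` by periodicity.
  have p1 := intervalIntegral.integral_mul_deriv_eq_deriv_mul_of_hasDerivAt (a := -Real.pi)
    (b := 0) (u := f) (v := v) (u' := f₁) (v' := e) H.cont.continuousOn hvc.continuousOn
    (fun x hx => H.deriv₁ x (by
      rw [min_eq_left (by linarith), max_eq_right (by linarith)] at hx
      exact (Real.sin_neg_of_neg_of_neg_pi_lt hx.2 hx.1).ne)) (fun x _ => hvd x) t1
    (hec.intervalIntegrable _ _)
  have p2 := intervalIntegral.integral_mul_deriv_eq_deriv_mul_of_hasDerivAt (a := 0)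
    (b := Real.pi) (u := f) (v := v) (u' := f₁) (v' := e) H.cont.continuousOn hvc.continuousOn
    (fun x hx => H.deriv₁ x (by
      rw [min_eq_left (by linarith), max_eq_right (by linarith)] at hx
      exact (Real.sin_pos_of_pos_of_lt_pi hx.1 hx.2).ne')) (fun x _ => hvd x) t2
    (hec.intervalIntegrable _ _)
  have hfe : Continuous fun x => f x * e x := H.cont.mul hec
  have hper : f Real.pi * v Real.pi = f (-Real.pi) * v (-Real.pi) := by
    have e1 : f Real.pi = f (-Real.pi) := by
      rw [← H.periodic (-Real.pi)]; congr 1; ring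
    have e2 : e Real.pi = e (-Real.pi) := by
      simp only [he]
      rw [Complex.exp_eq_exp_iff_exists_int]
      exact ⟨n, by push_cast; ring⟩
    simp only [hv, e1, e2]
  have htot : ∫ x in (-Real.pi)..Real.pi, f x * e x =
      -((Complex.I * (n : ℝ))⁻¹ * ∫ x in (-Real.pi)..Real.pi, f₁ x * e x) := by
    rw [← intervalIntegral.integral_add_adjacent_intervals
      (hfe.intervalIntegrable (-Real.pi) 0) (hfe.intervalIntegrable 0 Real.pi), p1, p2,
      ← intervalIntegral.integral_add_adjacent_intervals
      (t1.mul_continuousOn hec.continuousOn) (t2.mul_continuousOn hec.continuousOn), mul_add,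
      ← intervalIntegral.integral_const_mul, ← intervalIntegral.integral_const_mul]
    have e3 : ∀ x, (Complex.I * (n : ℝ))⁻¹ * (f₁ x * e x) = f₁ x * v x := fun x => by
      simp only [hv]; ring
    simp only [e3, hper]
    ring
  rw [htot, norm_neg, norm_mul, norm_inv, norm_mul, Complex.norm_I, one_mul, Complex.norm_real,
    Real.norm_eq_abs]
  refine (mul_le_mul_of_nonneg_left (hbound n hn1) (inv_nonneg.2 hn0.le)).trans (le_of_eq ?_)
  rw [sub_eq_add_neg, Real.rpow_add hn0, Real.rpow_neg_one]
  ring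

end SingularBound

/-! ### Absolute convergence of Fourier series, uniformly in the scale -/

/-- Convexity of `t ↦ t^{-γ}`: the graph lies above its tangent at `x`. This bounds a term of a sum
by a telescoping difference. -/
theorem rpow_neg_tangent_le {γ x y : ℝ} (hγ : 0 ≤ γ) (hx : 0 < x) (hy : 0 < y) :
    γ * (x - y) * x ^ (-1 - γ) ≤ y ^ (-γ) - x ^ (-γ) := by
  have ht : 0 < y / x := div_pos hy hx
  have h1 : 1 + γ * (1 - y / x) ≤ (y / x) ^ (-γ) := by
    rw [Real.rpow_def_of_pos ht]
    refine le_trans ?_ (Real.add_one_le_exp _)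
    have := mul_le_mul_of_nonneg_left (Real.log_le_sub_one_of_pos ht) hγ
    linarith
  have h2 := mul_le_mul_of_nonneg_left h1 (Real.rpow_nonneg hx.le (-γ))
  rw [← Real.mul_rpow hx.le ht.le, mul_div_cancel₀ _ hx.ne'] at h2
  have h3 : x ^ (-γ) = x * x ^ (-1 - γ) := by
    rw [mul_comm, ← Real.rpow_add_one hx.ne']; congr 1; ring
  have h4 : x ^ (-γ) * (1 + γ * (1 - y / x)) = x ^ (-γ) + γ * (x - y) * x ^ (-1 - γ) := by
    rw [h3]; field_simp
  linarith

/-- Uniform summability of the scaled majorant `N⁻¹ (1 + n/N)^{-1-γ}`. -/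
theorem summable_scaled_majorant {γ N : ℝ} (hγ : 0 < γ) (hN : 0 < N) :
    Summable (fun n : ℕ => N⁻¹ * (1 + (n + 1) / N) ^ (-1 - γ)) ∧
      ∑' n : ℕ, N⁻¹ * (1 + (n + 1) / N) ^ (-1 - γ) ≤ 1 / γ := by
  have hpos : ∀ n : ℕ, 0 < 1 + (n : ℝ) / N := fun n => by positivity
  have hnn : ∀ n : ℕ, 0 ≤ N⁻¹ * (1 + ((n : ℝ) + 1) / N) ^ (-1 - γ) := fun n => by positivity
  -- The sum is a Riemann sum with mesh `1/N` for the integral of `(1 + x)^{-1-γ}` over `[0, ∞)`,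
  -- which equals `1/γ`.
  have hstep : ∀ n : ℕ, N⁻¹ * (1 + ((n : ℝ) + 1) / N) ^ (-1 - γ) ≤
      1 / γ * ((1 + (n : ℝ) / N) ^ (-γ) - (1 + ((n + 1 : ℕ) : ℝ) / N) ^ (-γ)) := fun n => by
    have h := rpow_neg_tangent_le hγ.le (hpos (n + 1)) (hpos n)
    have e : 1 + ((n + 1 : ℕ) : ℝ) / N - (1 + (n : ℝ) / N) = N⁻¹ := by
      push_cast; field_simp; ring
    rw [e] at h
    rw [one_div, le_inv_mul_iff₀ hγ]
    push_cast at h ⊢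
    linarith
  have hpart : ∀ M : ℕ, ∑ n ∈ Finset.range M, N⁻¹ * (1 + ((n : ℝ) + 1) / N) ^ (-1 - γ) ≤
      1 / γ := fun M => by
    refine (Finset.sum_le_sum fun n _ => hstep n).trans ?_
    rw [← Finset.mul_sum, Finset.sum_range_sub' (fun n : ℕ => (1 + (n : ℝ) / N) ^ (-γ))]
    refine mul_le_of_le_one_right (by positivity) ?_
    have : 0 ≤ (1 + (M : ℝ) / N) ^ (-γ) := by positivity
    simp only [Nat.cast_zero, zero_div, add_zero, Real.one_rpow]
    linarith
  exact ⟨summable_of_sum_range_le hnn hpart, Real.tsum_le_of_sum_range_le hnn hpart⟩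

/-- The first bound serves for `m ≤ N`, the second for `m ≥ N`. The constant comes from `1 + m/N ≤ 2
max(1, m/N)` and `2^{1+γ} ≤ 4`. -/
theorem le_scaled_majorant {γ N x m : ℝ} (hγ : 0 < γ) (hγ1 : γ < 1) (hN : 0 < N) (hm : 0 < m)
    {A : ℝ} (hA : 0 ≤ A) (h1 : x ≤ A * N⁻¹) (h2 : x ≤ A * (N ^ γ * m ^ (-1 - γ))) :
    x ≤ 4 * A * (N⁻¹ * (1 + m / N) ^ (-1 - γ)) := by
  have h4 : (2 : ℝ) ^ (-1 - γ) * 4 ≥ 1 := by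
    have : (2 : ℝ) ^ (-2 : ℝ) ≤ 2 ^ (-1 - γ) :=
      Real.rpow_le_rpow_of_exponent_le (by norm_num) (by linarith)
    rw [Real.rpow_neg (by norm_num), Real.rpow_two] at this
    linarith
  have hp : -1 - γ ≤ 0 := by linarith
  rcases le_total m N with h | h
  · have : (2 : ℝ) ^ (-1 - γ) ≤ (1 + m / N) ^ (-1 - γ) := by
      refine Real.rpow_le_rpow_of_nonpos (by positivity) ?_ hp
      linarith [(div_le_one hN).2 h]
    refine h1.trans ?_
    have h5 : 0 ≤ A * N⁻¹ := by positivity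
    nlinarith [mul_le_mul_of_nonneg_left this h5, mul_le_mul_of_nonneg_left h4 h5]
  · have hmN : 1 ≤ m / N := (one_le_div hN).2 h
    have : (2 * (m / N)) ^ (-1 - γ) ≤ (1 + m / N) ^ (-1 - γ) :=
      Real.rpow_le_rpow_of_nonpos (by positivity) (by linarith) hp
    rw [Real.mul_rpow (by norm_num) (by positivity)] at this
    have e : N⁻¹ * (m / N) ^ (-1 - γ) = N ^ γ * m ^ (-1 - γ) := by
      rw [Real.div_rpow hm.le hN.le, sub_eq_add_neg, Real.rpow_add hN, Real.rpow_neg_one,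
        Real.rpow_neg hN.le]
      field_simp
    refine h2.trans ?_
    rw [← e]
    have h5 : 0 ≤ A * N⁻¹ := by positivity
    have h6 : 0 ≤ (m / N) ^ (-1 - γ) := by positivity
    have h7 : (m / N) ^ (-1 - γ) ≤ 4 * (1 + m / N) ^ (-1 - γ) := by nlinarith
    nlinarith [mul_le_mul_of_nonneg_left h7 h5]

theorem summable_int_of_le {b : ℤ → ℝ} {M : ℕ → ℝ} {A B : ℝ} (hb : ∀ n, 0 ≤ b n) (hA : b 0 ≤ A)
    (hM : Summable M) (hB : ∑' m, M m ≤ B) (h1 : ∀ m : ℕ, b ((m : ℤ) + 1) ≤ M m)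
    (h2 : ∀ m : ℕ, b (-((m : ℤ) + 1)) ≤ M m) :
    Summable b ∧ ∑' n, b n ≤ A + B + B := by
  have s1 : Summable fun m : ℕ => b ((m : ℤ) + 1) :=
    Summable.of_nonneg_of_le (fun _ => hb _) h1 hM
  have s1' : Summable fun m : ℕ => b (m : ℤ) :=
    (summable_nat_add_iff 1).1 (by simpa only [Nat.cast_add, Nat.cast_one] using s1)
  have s2 : Summable fun m : ℕ => b (-((m : ℤ) + 1)) :=
    Summable.of_nonneg_of_le (fun _ => hb _) h2 hM
  refine ⟨Summable.of_nat_of_neg_add_one s1' s2, ?_⟩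
  rw [tsum_of_nat_of_neg_add_one s1' s2, s1'.tsum_eq_zero_add]
  have e2 := (s1.tsum_le_tsum h1 hM).trans hB
  have e3 := (s2.tsum_le_tsum h2 hM).trans hB
  push_cast
  linarith

/-- The constant in `SingularBound.exists_fourier_expansion`. -/
def wienerConst (γ : ℝ) : ℝ := 1 + 2 * (4 * (16 * oscConst γ) * (1 / γ))

/-- A function with algebraic singularities at `0` and `π`, concentrated at scale `N⁻¹`, has an
absolutely convergent Fourier series, with a bound that does not depend on `N`. -/
theorem SingularBound.exists_fourier_expansion {γ A N : ℝ} {f f₁ f₂ : ℝ → ℂ}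
    (h0 : 0 < γ) (h1 : γ < 1) (hN : 0 < N) (H : SingularBound γ (A * N ^ γ) f f₁ f₂)
    (hf : ∀ x, ‖f x‖ ≤ A) (hint : ∫ x in (-Real.pi)..Real.pi, ‖f x‖ ≤ A * N⁻¹) :
    ∃ b : ℤ → ℂ, (Summable fun n => ‖b n‖) ∧ ∑' n, ‖b n‖ ≤ A * wienerConst γ ∧
      ∀ x : ℝ, HasSum (fun n : ℤ => b n * Complex.exp (Complex.I * x * n)) (f x) := by
  have hpi := Real.pi_pos
  have : Fact (0 < 2 * Real.pi) := ⟨by positivity⟩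
  have hA : 0 ≤ A := (norm_nonneg _).trans (hf 0)
  have hosc : 1 ≤ 16 * oscConst γ := by
    have e1 : 0 ≤ 1 / γ := by positivity
    have e2 : 0 ≤ 1 / (1 - γ) := one_div_nonneg.2 (by linarith)
    rw [oscConst]; linarith
  let F : C(AddCircle (2 * Real.pi), ℂ) :=
    ⟨H.periodic.lift, continuous_coinduced_dom.2 H.cont⟩
  have hF : ∀ x : ℝ, F (x : AddCircle (2 * Real.pi)) = f x := fun x => rfl
  have hfour : ∀ (n : ℤ) (x : ℝ), (fourier n (x : AddCircle (2 * Real.pi)) : ℂ) =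
      Complex.exp (Complex.I * x * n) := fun n x => by
    rw [fourier_coe_apply]
    congr 1
    push_cast
    have : (Real.pi : ℂ) ≠ 0 := by exact_mod_cast hpi.ne'
    field_simp
  have hb : ∀ n : ℤ, ‖fourierCoeff F n‖ ≤ (2 * Real.pi)⁻¹ *
      ‖∫ x in (-Real.pi)..Real.pi, f x * Complex.exp (Complex.I * ((-n : ℤ) : ℝ) * x)‖ :=
    fun n => by
    rw [fourierCoeff_eq_intervalIntegral _ _ (-Real.pi), norm_smul, one_div, norm_inv,
      Real.norm_of_nonneg (by positivity)]
    refine le_of_eq ?_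
    congr 2
    have e : -Real.pi + 2 * Real.pi = Real.pi := by ring
    rw [e]
    refine intervalIntegral.integral_congr fun x _ => ?_
    simp only [hF, hfour, smul_eq_mul]
    rw [mul_comm]
    congr 2
    push_cast; ring
  have hpi1 : (2 * Real.pi)⁻¹ ≤ 1 := inv_le_one_of_one_le₀ (by linarith [Real.two_le_pi])
  have hb' : ∀ n : ℤ, ‖fourierCoeff F n‖ ≤
      ‖∫ x in (-Real.pi)..Real.pi, f x * Complex.exp (Complex.I * ((-n : ℤ) : ℝ) * x)‖ :=
    fun n => (hb n).trans (mul_le_of_le_one_left (norm_nonneg _) hpi1)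
  have hle : ∀ (n : ℤ) (m : ℕ), |((-n : ℤ) : ℝ)| = (m : ℝ) + 1 → ‖fourierCoeff F n‖ ≤
      4 * (A * (16 * oscConst γ)) * (N⁻¹ * (1 + ((m : ℝ) + 1) / N) ^ (-1 - γ)) := by
    intro n m hnm
    have hm : (0 : ℝ) < (m : ℝ) + 1 := by positivity
    have hn : -n ≠ 0 := by
      rintro h
      rw [h] at hnm
      simp at hnm
      linarith
    -- The two bounds on the coefficient: the `L₁` norm of `f`, and the decay from
    -- `SingularBound.norm_integral_le`.
    refine le_scaled_majorant h0 h1 hN hm (by positivity) ((hb' n).trans ?_) ((hb' n).trans ?_)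
    · refine (intervalIntegral.norm_integral_le_integral_norm (by linarith)).trans ?_
      simp only [norm_mul, norm_exp_I_mul, mul_one]
      refine hint.trans ?_
      have : 0 ≤ A * N⁻¹ := by positivity
      nlinarith
    · refine (H.norm_integral_le h0 h1 hn).trans (le_of_eq ?_)
      rw [hnm]; ring
  obtain ⟨hs, hs'⟩ := summable_scaled_majorant h0 hN
  set K : ℝ := 4 * (A * (16 * oscConst γ)) with hK
  have hKs := hs.mul_left K
  have hl1 : ∀ m : ℕ, ‖fourierCoeff F (((m : ℤ) + 1))‖ ≤
      K * (N⁻¹ * (1 + ((m : ℝ) + 1) / N) ^ (-1 - γ)) := fun m => hle _ m (by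
    push_cast
    rw [abs_neg, abs_of_pos (by positivity)])
  have hl2 : ∀ m : ℕ, ‖fourierCoeff F (-((m : ℤ) + 1))‖ ≤
      K * (N⁻¹ * (1 + ((m : ℝ) + 1) / N) ^ (-1 - γ)) := fun m => hle _ m (by
    push_cast
    rw [neg_neg, abs_of_pos (by positivity)])
  -- The coefficient at `0` uses the supremum bound, because `A / N` is not bounded for small `N`.
  have hl0 : ‖fourierCoeff F 0‖ ≤ A := by
    refine (hb 0).trans ?_
    rw [inv_mul_le_iff₀ (by positivity)]
    refine (intervalIntegral.norm_integral_le_of_norm_le_const (C := A) fun x _ => ?_).trans ?_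
    · rw [norm_mul, norm_exp_I_mul, mul_one]; exact hf x
    · rw [abs_of_nonneg (by linarith)]; linarith
  have e1 : ∑' m : ℕ, K * (N⁻¹ * (1 + ((m : ℝ) + 1) / N) ^ (-1 - γ)) ≤ K * (1 / γ) := by
    rw [tsum_mul_left]
    exact mul_le_mul_of_nonneg_left hs' (by positivity)
  obtain ⟨hsum, hbound⟩ := summable_int_of_le (b := fun n => ‖fourierCoeff F n‖)
    (fun _ => norm_nonneg _) hl0 hKs e1 hl1 hl2
  refine ⟨fourierCoeff F, hsum, hbound.trans (le_of_eq ?_), fun x => ?_⟩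
  · rw [wienerConst, hK]; ring
  · have := has_pointwise_sum_fourier_series_of_summable (f := F) hsum.of_norm x
    simpa only [hfour, hF, smul_eq_mul] using this

/-! ### Derivatives and size of the symbols on the circle -/

/-- The building block `e^{iκx} (1 - e^{imx})^β`. -/
def expCpow (κ m : ℤ) (β x : ℝ) : ℂ :=
  Complex.exp (Complex.I * (κ : ℝ) * x) * (1 - Complex.exp (Complex.I * (m : ℝ) * x)) ^ (β : ℂ)

/-- The derivative of `expCpow`. -/
def expCpow' (κ m : ℤ) (β x : ℝ) : ℂ :=
  Complex.I * (κ : ℝ) * expCpow κ m β x -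
    Complex.I * (m * β : ℝ) * expCpow (κ + m) m (β - 1) x

/-- The second derivative of `expCpow`. -/
def expCpow'' (κ m : ℤ) (β x : ℝ) : ℂ :=
  Complex.I * (κ : ℝ) * expCpow' κ m β x -
    Complex.I * (m * β : ℝ) * expCpow' (κ + m) m (β - 1) x

theorem measurable_expCpow (κ m : ℤ) (β : ℝ) : Measurable (expCpow κ m β) := by
  unfold expCpow; fun_prop

theorem measurable_expCpow' (κ m : ℤ) (β : ℝ) : Measurable (expCpow' κ m β) :=
  ((measurable_expCpow _ _ _).const_mul _).sub ((measurable_expCpow _ _ _).const_mul _)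

theorem measurable_expCpow'' (κ m : ℤ) (β : ℝ) : Measurable (expCpow'' κ m β) :=
  ((measurable_expCpow' _ _ _).const_mul _).sub ((measurable_expCpow' _ _ _).const_mul _)

theorem continuous_expCpow (κ m : ℤ) {β : ℝ} (hβ : 0 < β) : Continuous (expCpow κ m β) := by
  refine Continuous.mul (by fun_prop) (continuous_iff_continuousAt.2 fun x => ?_)
  exact (continuousAt_one_sub_cpow hβ (norm_exp_I_mul (m : ℝ) x).le).comp
    (f := fun x : ℝ => Complex.exp (Complex.I * (m : ℝ) * x)) (by fun_prop)

theorem exp_I_int_mul_periodic (n : ℤ) (x : ℝ) :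
    Complex.exp (Complex.I * (n : ℝ) * ((x + 2 * Real.pi : ℝ) : ℂ)) =
      Complex.exp (Complex.I * (n : ℝ) * x) := by
  rw [Complex.exp_eq_exp_iff_exists_int]
  exact ⟨n, by push_cast; ring⟩

theorem periodic_expCpow (κ m : ℤ) (β : ℝ) :
    Function.Periodic (expCpow κ m β) (2 * Real.pi) := fun x => by
  simp only [expCpow, exp_I_int_mul_periodic]

theorem norm_expCpow (κ m : ℤ) (β x : ℝ) :
    ‖expCpow κ m β x‖ = ‖1 - Complex.exp (Complex.I * (m : ℝ) * x)‖ ^ β := by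
  rw [expCpow, norm_mul, norm_exp_I_mul, one_mul, Complex.norm_cpow_real]

theorem norm_one_sub_exp_le (m : ℝ) (x : ℝ) : ‖1 - Complex.exp (Complex.I * m * x)‖ ≤ 2 := by
  refine (norm_sub_le _ _).trans ?_
  rw [norm_exp_I_mul, norm_one]; norm_num

theorem norm_one_sub_exp (m x : ℝ) :
    ‖1 - Complex.exp (Complex.I * m * x)‖ = 2 * |Real.sin (m * x / 2)| := by
  have : Complex.I * m * x = Complex.I * ((m * x : ℝ) : ℂ) := by push_cast; ring
  rw [norm_sub_rev, this, Complex.norm_exp_I_mul_ofReal_sub_one, norm_mul, Real.norm_eq_abs,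
    Real.norm_eq_abs, abs_of_pos (two_pos : (0 : ℝ) < 2)]

theorem hasDerivAt_expCpow (κ m : ℤ) (β : ℝ) {x : ℝ}
    (hx : 1 - Complex.exp (Complex.I * (m : ℝ) * x) ≠ 0) :
    HasDerivAt (expCpow κ m β) (expCpow' κ m β x) x := by
  -- The real part is nonnegative, so a point outside the slit plane would have to be `0`.
  have hslit : 1 - Complex.exp (Complex.I * (m : ℝ) * x) ∈ Complex.slitPlane := by
    set z := Complex.exp (Complex.I * (m : ℝ) * x) with hz
    have hz1 : ‖z‖ = 1 := norm_exp_I_mul _ _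
    by_contra hns
    rw [Complex.mem_slitPlane_iff, not_or, not_lt, not_not] at hns
    obtain ⟨h1, h2⟩ := hns
    have h3 : z.re ≤ 1 := (Complex.re_le_norm z).trans hz1.le
    simp only [Complex.sub_re, Complex.one_re] at h1
    refine hx (Complex.ext ?_ h2)
    simp only [Complex.sub_re, Complex.one_re, Complex.zero_re]
    linarith
  have hexp : ∀ n : ℤ, HasDerivAt (fun y : ℝ => Complex.exp (Complex.I * (n : ℝ) * y))
      (Complex.I * (n : ℝ) * Complex.exp (Complex.I * (n : ℝ) * x)) x := fun n => by
    refine ((((hasDerivAt_id x).ofReal_comp).const_mul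
      (Complex.I * ((n : ℝ) : ℂ))).cexp).congr_deriv ?_
    simp only [id, Complex.ofReal_one, mul_one]
    rw [mul_comm]
  have hc := ((hasDerivAt_id (1 - Complex.exp (Complex.I * (m : ℝ) * x))).cpow_const
    (c := (β : ℂ)) hslit).scomp x ((hexp m).const_sub 1)
  refine ((hexp κ).mul hc).congr_deriv ?_
  simp only [expCpow', expCpow, Function.comp_apply, id, smul_eq_mul]
  -- The factor `e^{imx}` from the chain rule shifts `κ` to `κ + m`, so derivatives stay in the span
  -- of the same family.
  have e : Complex.exp (Complex.I * ((κ + m : ℤ) : ℝ) * x) =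
      Complex.exp (Complex.I * (κ : ℝ) * x) * Complex.exp (Complex.I * (m : ℝ) * x) := by
    rw [← Complex.exp_add]; congr 1; push_cast; ring
  rw [e]
  push_cast
  ring

theorem hasDerivAt_expCpow' (κ m : ℤ) (β : ℝ) {x : ℝ}
    (hx : 1 - Complex.exp (Complex.I * (m : ℝ) * x) ≠ 0) :
    HasDerivAt (expCpow' κ m β) (expCpow'' κ m β x) x :=
  ((hasDerivAt_expCpow κ m β hx).const_mul _).sub ((hasDerivAt_expCpow _ m _ hx).const_mul _)

/-- The less singular term is absorbed using `r ≤ 2`, that is `r^β ≤ 2 r^{β-1}`. -/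
theorem norm_expCpow'_le (κ m : ℤ) (β : ℝ) {x : ℝ}
    (hx : 1 - Complex.exp (Complex.I * (m : ℝ) * x) ≠ 0) :
    ‖expCpow' κ m β x‖ ≤ (2 * |(κ : ℝ)| + |m * β|) *
      ‖1 - Complex.exp (Complex.I * (m : ℝ) * x)‖ ^ (β - 1) := by
  set r := ‖1 - Complex.exp (Complex.I * (m : ℝ) * x)‖ with hr
  have hr0 : 0 < r := norm_pos_iff.2 hx
  have hr2 : r ≤ 2 := norm_one_sub_exp_le _ _
  have e : r ^ β ≤ 2 * r ^ (β - 1) := by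
    have : r ^ β = r * r ^ (β - 1) := by
      rw [mul_comm, ← Real.rpow_add_one hr0.ne', sub_add_cancel]
    rw [this]
    exact mul_le_mul_of_nonneg_right hr2 (Real.rpow_nonneg hr0.le _)
  refine (norm_sub_le _ _).trans ?_
  simp only [norm_mul, Complex.norm_I, one_mul, Complex.norm_real, Real.norm_eq_abs, norm_expCpow,
    ← hr]
  rw [← abs_mul]
  nlinarith [mul_le_mul_of_nonneg_left e (abs_nonneg (κ : ℝ))]

theorem norm_expCpow''_le (κ m : ℤ) (β : ℝ) : ∃ C : ℝ, 0 ≤ C ∧ ∀ x : ℝ,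
    1 - Complex.exp (Complex.I * (m : ℝ) * x) ≠ 0 →
      ‖expCpow'' κ m β x‖ ≤ C * ‖1 - Complex.exp (Complex.I * (m : ℝ) * x)‖ ^ (β - 2) := by
  refine ⟨2 * |(κ : ℝ)| * (2 * |(κ : ℝ)| + |m * β|) +
    |m * β| * (2 * |((κ + m : ℤ) : ℝ)| + |m * (β - 1)|), by positivity, fun x hx => ?_⟩
  have h1 := norm_expCpow'_le κ m β hx
  have h2 := norm_expCpow'_le (κ + m) m (β - 1) hx
  set r := ‖1 - Complex.exp (Complex.I * (m : ℝ) * x)‖ with hr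
  have hr0 : 0 < r := norm_pos_iff.2 hx
  have hr2 : r ≤ 2 := norm_one_sub_exp_le _ _
  have e1 : β - 1 - 1 = β - 2 := by ring
  rw [e1] at h2
  have e : r ^ (β - 1) ≤ 2 * r ^ (β - 2) := by
    have : r ^ (β - 1) = r * r ^ (β - 2) := by
      rw [mul_comm, ← Real.rpow_add_one hr0.ne']; congr 1; ring
    rw [this]
    exact mul_le_mul_of_nonneg_right hr2 (Real.rpow_nonneg hr0.le _)
  refine (norm_sub_le _ _).trans ?_
  simp only [norm_mul, Complex.norm_I, one_mul, Complex.norm_real, Real.norm_eq_abs]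
  rw [← abs_mul]
  have h3 := h1.trans (mul_le_mul_of_nonneg_left e (by positivity))
  calc _ ≤ |(κ : ℝ)| * ((2 * |(κ : ℝ)| + |m * β|) * (2 * r ^ (β - 2))) +
        |m * β| * ((2 * |((κ + m : ℤ) : ℝ)| + |m * (β - 1)|) * r ^ (β - 2)) :=
        add_le_add (mul_le_mul_of_nonneg_left h3 (abs_nonneg _))
          (mul_le_mul_of_nonneg_left h2 (abs_nonneg _))
    _ = _ := by ring

/-- Comparison of powers of `r ∈ {R, ρ}` where `ρ ≤ 2R`. -/
theorem rpow_le_rpow_mul_rpow {γ R t r : ℝ} (h0 : 0 < γ) (h1 : γ < 1) (ht : 0 < t) (htR : t ≤ R)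
    (hr : r = R ∨ r = 2 * t) :
    r ^ (2 * γ) ≤ 4 * (R ^ γ) ^ 2 ∧ r ^ (2 * γ - 1) ≤ 2 * (R ^ γ * t ^ (γ - 1)) ∧
      r ^ (2 * γ - 2) ≤ 2 * (R ^ γ * t ^ (γ - 2)) := by
  have hR : 0 < R := ht.trans_le htR
  have hr0 : 0 < r := by rcases hr with rfl | rfl <;> linarith
  have htr : t ≤ r := by rcases hr with rfl | rfl <;> linarith
  have hrR : r ≤ 2 * R := by rcases hr with rfl | rfl <;> linarith
  have hγ : r ^ γ ≤ 2 * R ^ γ := by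
    refine (Real.rpow_le_rpow hr0.le hrR h0.le).trans ?_
    rw [Real.mul_rpow two_pos.le hR.le]
    refine mul_le_mul_of_nonneg_right ?_ (by positivity)
    simpa using Real.rpow_le_rpow_of_exponent_le one_le_two h1.le
  -- Half of the exponent `2γ` is spent on `R^γ`, through `r ≤ 2R`; the remaining negative power is
  -- bounded through `r ≥ t`.
  have key : ∀ p : ℝ, p ≤ 0 → r ^ (γ + p) ≤ 2 * (R ^ γ * t ^ p) := fun p hp => by
    rw [Real.rpow_add hr0, ← mul_assoc]
    exact mul_le_mul hγ (Real.rpow_le_rpow_of_nonpos ht htr hp) (by positivity) (by positivity)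
  refine ⟨?_, ?_, ?_⟩
  · rw [two_mul, Real.rpow_add hr0, ← sq]
    calc (r ^ γ) ^ 2 ≤ (2 * R ^ γ) ^ 2 := pow_le_pow_left₀ (by positivity) hγ 2
      _ = _ := by ring
  · have := key (γ - 1) (by linarith)
    rwa [show γ + (γ - 1) = 2 * γ - 1 by ring] at this
  · have := key (γ - 2) (by linarith)
    rwa [show γ + (γ - 2) = 2 * γ - 2 by ring] at this

/-- The symbol `e^{iκx} (A (1 - e^{ix})^α + B (1 - e^{2ix})^α)` on the circle. -/
def coreSymbol (κ : ℤ) (α A B x : ℝ) : ℂ := A * expCpow κ 1 α x + B * expCpow κ 2 α x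

/-- The derivative of `coreSymbol`. -/
def coreSymbol' (κ : ℤ) (α A B x : ℝ) : ℂ := A * expCpow' κ 1 α x + B * expCpow' κ 2 α x

/-- The second derivative of `coreSymbol`. -/
def coreSymbol'' (κ : ℤ) (α A B x : ℝ) : ℂ := A * expCpow'' κ 1 α x + B * expCpow'' κ 2 α x

theorem norm_one_sub_exp_one (x : ℝ) :
    ‖1 - Complex.exp (Complex.I * ((1 : ℤ) : ℝ) * x)‖ = 2 * |Real.sin (x / 2)| := by
  rw [norm_one_sub_exp, Int.cast_one, one_mul]

theorem norm_one_sub_exp_two (x : ℝ) :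
    ‖1 - Complex.exp (Complex.I * ((2 : ℤ) : ℝ) * x)‖ = 2 * |Real.sin x| := by
  rw [norm_one_sub_exp, Int.cast_ofNat, mul_div_cancel_left₀ _ two_ne_zero]

theorem abs_sin_le_two_mul (x : ℝ) : |Real.sin x| ≤ 2 * |Real.sin (x / 2)| := by
  have : Real.sin x = 2 * Real.sin (x / 2) * Real.cos (x / 2) := by
    rw [← Real.sin_two_mul]; congr 1; ring
  rw [this, abs_mul, abs_mul, abs_of_pos (two_pos : (0 : ℝ) < 2)]
  exact mul_le_of_le_one_right (by positivity) (Real.abs_cos_le_one _)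

section coreSymbol

variable (κ : ℤ) (α A B : ℝ)

theorem one_sub_exp_ne_zero {x : ℝ} (hx : Real.sin x ≠ 0) :
    1 - Complex.exp (Complex.I * ((1 : ℤ) : ℝ) * x) ≠ 0 ∧
      1 - Complex.exp (Complex.I * ((2 : ℤ) : ℝ) * x) ≠ 0 := by
  have h := abs_pos.2 hx
  constructor
  · rw [← norm_pos_iff, norm_one_sub_exp_one]
    linarith [abs_sin_le_two_mul x]
  · rw [← norm_pos_iff, norm_one_sub_exp_two]
    linarith

theorem hasDerivAt_coreSymbol {x : ℝ} (hx : Real.sin x ≠ 0) :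
    HasDerivAt (coreSymbol κ α A B) (coreSymbol' κ α A B x) x :=
  ((hasDerivAt_expCpow κ 1 α (one_sub_exp_ne_zero hx).1).const_mul _).add
    ((hasDerivAt_expCpow κ 2 α (one_sub_exp_ne_zero hx).2).const_mul _)

theorem hasDerivAt_coreSymbol' {x : ℝ} (hx : Real.sin x ≠ 0) :
    HasDerivAt (coreSymbol' κ α A B) (coreSymbol'' κ α A B x) x :=
  ((hasDerivAt_expCpow' κ 1 α (one_sub_exp_ne_zero hx).1).const_mul _).add
    ((hasDerivAt_expCpow' κ 2 α (one_sub_exp_ne_zero hx).2).const_mul _)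

theorem periodic_coreSymbol : Function.Periodic (coreSymbol κ α A B) (2 * Real.pi) := fun x => by
  simp only [coreSymbol, periodic_expCpow _ _ _ x]

theorem continuous_coreSymbol (hα : 0 < α) : Continuous (coreSymbol κ α A B) :=
  (continuous_const.mul (continuous_expCpow κ 1 hα)).add
    (continuous_const.mul (continuous_expCpow κ 2 hα))

/-- Size of the symbol and of its first two derivatives, in terms of
`R = |1 - e^{ix}| = 2 |sin (x/2)|` and of `|sin x|`, where `α = 2γ`. -/
theorem exists_coreSymbol_bound {γ : ℝ} (h0 : 0 < γ) (h1 : γ < 1) :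
    ∃ C : ℝ, 0 ≤ C ∧
      (∀ x, ‖coreSymbol κ (2 * γ) A B x‖ ≤ C * ((2 * |Real.sin (x / 2)|) ^ γ) ^ 2) ∧
      (∀ x, Real.sin x ≠ 0 → ‖coreSymbol' κ (2 * γ) A B x‖ ≤
        C * ((2 * |Real.sin (x / 2)|) ^ γ * |Real.sin x| ^ (γ - 1))) ∧
      (∀ x, Real.sin x ≠ 0 → ‖coreSymbol'' κ (2 * γ) A B x‖ ≤
        C * ((2 * |Real.sin (x / 2)|) ^ γ * |Real.sin x| ^ (γ - 2))) := by
  obtain ⟨C₁, hC₁, hb₁⟩ := norm_expCpow''_le κ 1 (2 * γ)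
  obtain ⟨C₂, hC₂, hb₂⟩ := norm_expCpow''_le κ 2 (2 * γ)
  set c₁ : ℝ := 2 * |(κ : ℝ)| + |((1 : ℤ) : ℝ) * (2 * γ)| with hc₁
  set c₂ : ℝ := 2 * |(κ : ℝ)| + |((2 : ℤ) : ℝ) * (2 * γ)| with hc₂
  have hc₁0 : 0 ≤ c₁ := by positivity
  have hc₂0 : 0 ≤ c₂ := by positivity
  have hA := abs_nonneg A
  have hB := abs_nonneg B
  set K : ℝ := 4 + 2 * (c₁ + c₂) + 2 * (C₁ + C₂) with hK
  have hadd : ∀ {a b X Y T k₁ k₂ : ℝ}, 0 ≤ T → k₁ ≤ K → k₂ ≤ K → a ≤ k₁ * T → b ≤ k₂ * T →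
      X = |A| * a → Y = |B| * b → X + Y ≤ (|A| + |B|) * K * T := by
    intro a b X Y T k₁ k₂ hT hk₁ hk₂ ha hb hX hY
    have e1 := mul_le_mul_of_nonneg_left (ha.trans (mul_le_mul_of_nonneg_right hk₁ hT)) hA
    have e2 := mul_le_mul_of_nonneg_left (hb.trans (mul_le_mul_of_nonneg_right hk₂ hT)) hB
    rw [hX, hY]
    linarith
  refine ⟨(|A| + |B|) * K, by positivity, fun x => ?_, fun x hx => ?_, fun x hx => ?_⟩
  · refine (norm_add_le _ _).trans ?_
    rw [norm_mul, norm_mul, Complex.norm_real, Complex.norm_real, Real.norm_eq_abs,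
      Real.norm_eq_abs, norm_expCpow, norm_expCpow, norm_one_sub_exp_one, norm_one_sub_exp_two]
    have e1 : (2 * |Real.sin (x / 2)|) ^ (2 * γ) = ((2 * |Real.sin (x / 2)|) ^ γ) ^ 2 := by
      rw [mul_comm 2 γ, Real.rpow_mul (by positivity), Real.rpow_two]
    refine hadd (k₁ := 1) (k₂ := 4) (by positivity) (by rw [hK]; linarith) (by rw [hK]; linarith)
      ?_ ?_ rfl rfl
    · rw [e1, one_mul]
    · by_cases hx : Real.sin x = 0
      · rw [hx, abs_zero, mul_zero, Real.zero_rpow (by positivity)]; positivity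
      · exact (rpow_le_rpow_mul_rpow h0 h1 (abs_pos.2 hx) (abs_sin_le_two_mul x) (Or.inr rfl)).1
  · obtain ⟨n1, n2⟩ := one_sub_exp_ne_zero hx
    have p1 := rpow_le_rpow_mul_rpow h0 h1 (abs_pos.2 hx) (abs_sin_le_two_mul x) (Or.inl rfl)
    have p2 := rpow_le_rpow_mul_rpow h0 h1 (abs_pos.2 hx) (abs_sin_le_two_mul x) (Or.inr rfl)
    have b1 := norm_expCpow'_le κ 1 (2 * γ) n1
    have b2 := norm_expCpow'_le κ 2 (2 * γ) n2
    rw [norm_one_sub_exp_one, ← hc₁] at b1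
    rw [norm_one_sub_exp_two, ← hc₂] at b2
    refine (norm_add_le _ _).trans ?_
    rw [norm_mul, norm_mul, Complex.norm_real, Complex.norm_real, Real.norm_eq_abs,
      Real.norm_eq_abs]
    refine hadd (k₁ := 2 * c₁) (k₂ := 2 * c₂) (by positivity) (by rw [hK]; linarith)
      (by rw [hK]; linarith) (b1.trans ?_) (b2.trans ?_) rfl rfl
    · exact (mul_le_mul_of_nonneg_left p1.2.1 hc₁0).trans_eq (by ring)
    · exact (mul_le_mul_of_nonneg_left p2.2.1 hc₂0).trans_eq (by ring)
  · obtain ⟨n1, n2⟩ := one_sub_exp_ne_zero hx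
    have p1 := rpow_le_rpow_mul_rpow h0 h1 (abs_pos.2 hx) (abs_sin_le_two_mul x) (Or.inl rfl)
    have p2 := rpow_le_rpow_mul_rpow h0 h1 (abs_pos.2 hx) (abs_sin_le_two_mul x) (Or.inr rfl)
    have b1 := hb₁ x n1
    have b2 := hb₂ x n2
    rw [norm_one_sub_exp_one] at b1
    rw [norm_one_sub_exp_two] at b2
    refine (norm_add_le _ _).trans ?_
    rw [norm_mul, norm_mul, Complex.norm_real, Complex.norm_real, Real.norm_eq_abs,
      Real.norm_eq_abs]
    refine hadd (k₁ := 2 * C₁) (k₂ := 2 * C₂) (by positivity) (by rw [hK]; linarith)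
      (by rw [hK]; linarith) (b1.trans ?_) (b2.trans ?_) rfl rfl
    · exact (mul_le_mul_of_nonneg_left p1.2.2 hC₁).trans_eq (by ring)
    · exact (mul_le_mul_of_nonneg_left p2.2.2 hC₂).trans_eq (by ring)

end coreSymbol

/-! ### Entire functions of the scaled symbol -/

/-- The power is at most `n!/c^n · e^{c(1+x)}`, and `c(1 + x) - c x² ≤ 2c`. -/
theorem exists_pow_mul_exp_neg_sq_le {c : ℝ} (hc : 0 < c) (n : ℕ) :
    ∃ K : ℝ, 0 ≤ K ∧ ∀ x : ℝ, 0 ≤ x → (1 + x) ^ n * Real.exp (-c * x ^ 2) ≤ K := by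
  refine ⟨n.factorial / c ^ n * Real.exp (2 * c), by positivity, fun x hx => ?_⟩
  have h1 := Real.pow_div_factorial_le_exp (c * (1 + x)) (by positivity) n
  have h2 : (1 + x) ^ n ≤ n.factorial / c ^ n * Real.exp (c * (1 + x)) := by
    rw [div_le_iff₀ (by positivity), mul_pow] at h1
    rw [div_mul_eq_mul_div, le_div_iff₀ (by positivity)]
    linarith
  refine (mul_le_mul_of_nonneg_right h2 (Real.exp_pos _).le).trans ?_
  rw [mul_assoc, ← Real.exp_add]
  refine mul_le_mul_of_nonneg_left (Real.exp_le_exp.2 ?_) (by positivity)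
  nlinarith [mul_nonneg hc.le (sq_nonneg (x - 1)), mul_nonneg hc.le hx]

/-- By Jordan's inequality `2 |sin(x/2)| ≥ (2/π)|x|` on `[-π, π]`, so an arctangent integral
dominates, with value at most `π²/(2N) ≤ 5/N`. -/
theorem integral_inv_one_add_sq_sin_le {N : ℝ} (hN : 0 < N) :
    ∫ x in (-Real.pi)..Real.pi, (1 + (N * (2 * |Real.sin (x / 2)|)) ^ 2)⁻¹ ≤ 5 * N⁻¹ := by
  have hpi := Real.pi_pos
  set k : ℝ := 2 * N / Real.pi with hk
  have hk0 : 0 < k := by positivity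
  have hcont : Continuous fun x : ℝ => (1 + (k * x) ^ 2)⁻¹ :=
    Continuous.inv₀ (by fun_prop) fun x => by positivity
  have hcont' : Continuous fun x : ℝ => (1 + (N * (2 * |Real.sin (x / 2)|)) ^ 2)⁻¹ :=
    Continuous.inv₀ (by fun_prop) fun x => by positivity
  have hmono : ∫ x in (-Real.pi)..Real.pi, (1 + (N * (2 * |Real.sin (x / 2)|)) ^ 2)⁻¹ ≤
      ∫ x in (-Real.pi)..Real.pi, (1 + (k * x) ^ 2)⁻¹ := by
    refine intervalIntegral.integral_mono_on (by linarith) (hcont'.intervalIntegrable _ _)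
      (hcont.intervalIntegrable _ _) fun x hx => ?_
    refine inv_anti₀ (by positivity) (add_le_add_right ?_ 1)
    rw [← sq_abs (k * x)]
    refine pow_le_pow_left₀ (abs_nonneg _) ?_ 2
    have h := Real.mul_abs_le_abs_sin (x := x / 2) (by
      rw [abs_le]; constructor <;> linarith [hx.1, hx.2])
    rw [abs_mul, abs_of_pos hk0, hk]
    rw [abs_div, abs_of_pos (two_pos : (0 : ℝ) < 2)] at h
    calc 2 * N / Real.pi * |x| = N * (2 * (2 / Real.pi * (|x| / 2))) := by ring
      _ ≤ _ := by gcongr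
  refine hmono.trans ?_
  rw [intervalIntegral.integral_comp_mul_left (fun y : ℝ => (1 + y ^ 2)⁻¹) hk0.ne',
    integral_inv_one_add_sq, smul_eq_mul]
  have h1 := Real.arctan_lt_pi_div_two (k * Real.pi)
  have h2 := Real.neg_pi_div_two_lt_arctan (k * -Real.pi)
  have h3 : k⁻¹ * (Real.arctan (k * Real.pi) - Real.arctan (k * -Real.pi)) ≤ k⁻¹ * Real.pi :=
    mul_le_mul_of_nonneg_left (by linarith) (inv_nonneg.2 hk0.le)
  refine h3.trans ?_
  have h4 : k⁻¹ * Real.pi = Real.pi ^ 2 / 2 * N⁻¹ := by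
    rw [hk]; field_simp
  rw [h4]
  refine mul_le_mul_of_nonneg_right ?_ (inv_nonneg.2 hN.le)
  nlinarith [Real.pi_lt_d2, Real.pi_pos]

theorem cubic_mul_le {y C E K : ℝ} (hy : 0 ≤ y) (hC : 0 ≤ C) (hE : 0 ≤ E)
    (hk : (1 + y) ^ 5 * E ≤ K) :
    (C * y + C ^ 2 * y ^ 3) * ((1 + y) ^ 2 * E) ≤ (1 + C + C ^ 2) * K := by
  have e1 : y ≤ (1 + y) ^ 3 := by nlinarith [pow_nonneg hy 2, pow_nonneg hy 3]
  have e2 : y ^ 3 ≤ (1 + y) ^ 3 := pow_le_pow_left₀ hy (by linarith) 3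
  have e3 : 0 ≤ (1 + y) ^ 3 := by positivity
  have e4 : C * y + C ^ 2 * y ^ 3 ≤ (1 + C + C ^ 2) * (1 + y) ^ 3 := by
    linarith [mul_le_mul_of_nonneg_left e1 hC, mul_le_mul_of_nonneg_left e2 (sq_nonneg C)]
  calc _ ≤ (1 + C + C ^ 2) * (1 + y) ^ 3 * ((1 + y) ^ 2 * E) :=
        mul_le_mul_of_nonneg_right e4 (by positivity)
    _ = (1 + C + C ^ 2) * ((1 + y) ^ 5 * E) := by ring
    _ ≤ _ := mul_le_mul_of_nonneg_left hk (by positivity)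

set_option maxHeartbeats 1000000 in
/-- If `G` is a symbol with `Re G ≤ -c |1 - e^{ix}|^α`, then the functions `g (s G)`, `s > 0`, have
uniformly absolutely convergent Fourier series, for `g` an entire function that is, together with
its first two derivatives, of size `O((1 + |z|) e^{Re z})`. -/
theorem exists_uniform_fourier_expansion {γ c A B M : ℝ} {κ : ℤ} (h0 : 0 < γ) (h1 : γ < 1)
    (hc : 0 < c)
    (hre : ∀ x, (coreSymbol κ (2 * γ) A B x).re ≤ -c * ((2 * |Real.sin (x / 2)|) ^ γ) ^ 2)
    {g g₁ g₂ : ℂ → ℂ} (hg : ∀ z, HasDerivAt g (g₁ z) z) (hg₁ : ∀ z, HasDerivAt g₁ (g₂ z) z)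
    (hg₂ : Continuous g₂) (hM : ∀ z, ‖g z‖ ≤ M * ((1 + ‖z‖) * Real.exp z.re))
    (hM₁ : ∀ z, ‖g₁ z‖ ≤ M * ((1 + ‖z‖) * Real.exp z.re))
    (hM₂ : ∀ z, ‖g₂ z‖ ≤ M * ((1 + ‖z‖) * Real.exp z.re)) :
    ∃ K : ℝ, ∀ s : ℝ, 0 < s → ∃ b : ℤ → ℂ, (Summable fun n => ‖b n‖) ∧ ∑' n, ‖b n‖ ≤ K ∧
      ∀ x : ℝ, HasSum (fun n : ℤ => b n * Complex.exp (Complex.I * x * n))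
        (g (s * coreSymbol κ (2 * γ) A B x)) := by
  obtain ⟨C, hC, hG, hG₁, hG₂⟩ := exists_coreSymbol_bound κ A B h0 h1
  -- With `X = N |1 - e^{ix}|` and `y = X^γ`, the exponent `n ≥ 2/γ` gives `X² ≤ (1 + y)^n`. The
  -- extra `3` provides the fifth power of `1 + y` needed for the second derivative.
  set n : ℕ := ⌈2 / γ⌉₊ + 3 with hn
  obtain ⟨K, hK0, hK⟩ := exists_pow_mul_exp_neg_sq_le hc (n + 2)
  have hM0 : 0 ≤ M := by
    have := (norm_nonneg _).trans (hM 0)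
    simpa using this
  set L : ℝ := 2 * (M * ((1 + C) * (1 + C + C ^ 2))) * K with hL
  have hL0 : 0 ≤ L := by positivity
  refine ⟨5 * L * wienerConst γ, fun s hs => ?_⟩
  -- Chosen so that `s = N^{2γ} = σ²`; then `s |1 - e^{ix}|^{2γ} = (N |1 - e^{ix}|)^{2γ}`.
  set N : ℝ := s ^ (1 / (2 * γ)) with hNdef
  have hN : 0 < N := Real.rpow_pos_of_pos hs _
  set σ : ℝ := N ^ γ with hσ
  have hσ0 : 0 < σ := Real.rpow_pos_of_pos hN _
  have hσ2 : σ ^ 2 = s := by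
    rw [hσ, hNdef, ← Real.rpow_mul hs.le, ← Real.rpow_natCast, ← Real.rpow_mul hs.le]
    have : 1 / (2 * γ) * γ * ((2 : ℕ) : ℝ) = 1 := by push_cast; field_simp
    rw [this, Real.rpow_one]
  set G := coreSymbol κ (2 * γ) A B with hGdef
  set e : ℝ → ℝ := fun x => (2 * |Real.sin (x / 2)|) ^ γ with he
  have he0 : ∀ x, 0 ≤ e x := fun x => by positivity
  -- the common bound for `g`, `g₁` and `g₂`
  have hgen : ∀ {u : ℂ → ℂ}, (∀ z, ‖u z‖ ≤ M * ((1 + ‖z‖) * Real.exp z.re)) → ∀ x : ℝ,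
      ‖u (s * G x)‖ ≤
        M * (1 + C) * ((1 + σ * e x) ^ 2 * Real.exp (-c * (σ * e x) ^ 2)) := by
    intro u hu x
    refine (hu _).trans ?_
    rw [mul_assoc M]
    refine mul_le_mul_of_nonneg_left ?_ hM0
    rw [← mul_assoc]
    have hy : 0 ≤ σ * e x := mul_nonneg hσ0.le (he0 x)
    refine mul_le_mul ?_ (Real.exp_le_exp.2 ?_) (Real.exp_pos _).le (by positivity)
    · rw [norm_mul, Complex.norm_real, Real.norm_of_nonneg hs.le]
      have := mul_le_mul_of_nonneg_left (hG x) hs.le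
      have e1 : s * (C * e x ^ 2) = C * (σ * e x) ^ 2 := by rw [← hσ2]; ring
      rw [e1] at this
      nlinarith [mul_nonneg hC hy]
    · rw [Complex.re_ofReal_mul]
      have := mul_le_mul_of_nonneg_left (hre x) hs.le
      refine this.trans (le_of_eq ?_)
      rw [← hσ2]; ring
  have hmono : ∀ {y : ℝ} {k : ℕ}, 0 ≤ y → k ≤ n + 2 →
      (1 + y) ^ k * Real.exp (-c * y ^ 2) ≤ K := fun {y k} hy hk =>
    (mul_le_mul_of_nonneg_right (pow_le_pow_right₀ (by linarith) hk) (Real.exp_pos _).le).trans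
      (hK y hy)
  have hdg : Continuous g := continuous_iff_continuousAt.2 fun z => (hg z).continuousAt
  have hdg₁ : Continuous g₁ := continuous_iff_continuousAt.2 fun z => (hg₁ z).continuousAt
  have hGc : Continuous G := continuous_coreSymbol κ _ A B (by linarith)
  have hG₁m : Measurable (coreSymbol' κ (2 * γ) A B) :=
    ((measurable_expCpow' _ _ _).const_mul _).add ((measurable_expCpow' _ _ _).const_mul _)
  have hG₂m : Measurable (coreSymbol'' κ (2 * γ) A B) :=
    ((measurable_expCpow'' _ _ _).const_mul _).add ((measurable_expCpow'' _ _ _).const_mul _)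
  have hsG : Continuous fun x => (s : ℂ) * G x := continuous_const.mul hGc
  set f₁ : ℝ → ℂ := fun x => s * coreSymbol' κ (2 * γ) A B x * g₁ (s * G x) with hf₁
  set f₂ : ℝ → ℂ := fun x => s * coreSymbol'' κ (2 * γ) A B x * g₁ (s * G x) +
    s * coreSymbol' κ (2 * γ) A B x * (s * coreSymbol' κ (2 * γ) A B x * g₂ (s * G x)) with hf₂
  have hder : ∀ x, Real.sin x ≠ 0 →
      HasDerivAt (fun x => (s : ℂ) * G x) (s * coreSymbol' κ (2 * γ) A B x) x := fun x hx =>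
    (hasDerivAt_coreSymbol κ (2 * γ) A B hx).const_mul _
  -- Of the two factors in `s = σ²`, one remains as the admissible growth `N^γ`; the other forms `σ
  -- * e x`, which the Gaussian factor absorbs.
  have hle₁ : ∀ x, Real.sin x ≠ 0 → ‖s * coreSymbol' κ (2 * γ) A B x‖ ≤
      C * σ * (σ * e x) * |Real.sin x| ^ (γ - 1) := fun x hx => by
    rw [norm_mul, Complex.norm_real, Real.norm_of_nonneg hs.le]
    refine (mul_le_mul_of_nonneg_left (hG₁ x hx) hs.le).trans (le_of_eq ?_)
    rw [← hσ2]; simp only [he]; ring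
  have hle₂ : ∀ x, Real.sin x ≠ 0 → ‖s * coreSymbol'' κ (2 * γ) A B x‖ ≤
      C * σ * (σ * e x) * |Real.sin x| ^ (γ - 2) := fun x hx => by
    rw [norm_mul, Complex.norm_real, Real.norm_of_nonneg hs.le]
    refine (mul_le_mul_of_nonneg_left (hG₂ x hx) hs.le).trans (le_of_eq ?_)
    rw [← hσ2]; simp only [he]; ring
  have hC1 : (1 : ℝ) ≤ 1 + C + C ^ 2 := by nlinarith
  have hMC : 0 ≤ M * (1 + C) := by positivity
  have hY : ∀ x, 0 ≤ σ * e x := fun x => mul_nonneg hσ0.le (he0 x)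
  have hsing : SingularBound γ (5 * L * N ^ γ) (fun x => g (s * G x)) f₁ f₂ := by
    refine ⟨hdg.comp hsG, fun x => ?_, ?_, ?_, fun x hx => ?_, fun x hx => ?_, fun x hx => ?_,
      fun x hx => ?_⟩
    · simp only [hGdef, periodic_coreSymbol κ (2 * γ) A B x]
    · exact (hG₁m.const_mul _).mul (hdg₁.comp hsG).measurable
    · exact ((hG₂m.const_mul _).mul (hdg₁.comp hsG).measurable).add
        ((hG₁m.const_mul _).mul ((hG₁m.const_mul _).mul (hg₂.comp hsG).measurable))
    · exact (hg _).scomp x (hder x hx)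
    · exact ((hasDerivAt_coreSymbol' κ (2 * γ) A B hx).const_mul (s : ℂ)).mul
        ((hg₁ _).scomp x (hder x hx))
    · have hy := hY x
      set y := σ * e x with hydef
      set S := |Real.sin x| ^ (γ - 1) with hS
      have hS0 : 0 ≤ S := by positivity
      have hE := (Real.exp_pos (-c * y ^ 2)).le
      set E := Real.exp (-c * y ^ 2) with hEdef
      have hk : (1 + y) ^ 3 * E ≤ K := hmono hy (by omega)
      rw [hf₁, norm_mul]
      calc _ ≤ C * σ * y * S * (M * (1 + C) * ((1 + y) ^ 2 * E)) :=
            mul_le_mul (hle₁ x hx) (hgen hM₁ x) (norm_nonneg _) (by positivity)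
        _ = σ * S * (M * (1 + C)) * (C * (y * ((1 + y) ^ 2 * E))) := by ring
        _ ≤ σ * S * (M * (1 + C)) * ((1 + C + C ^ 2) * K) := by
            refine mul_le_mul_of_nonneg_left ?_ (by positivity)
            refine mul_le_mul (by nlinarith) ?_ (by positivity) (by positivity)
            refine le_trans ?_ hk
            have : 0 ≤ (1 + y) ^ 2 * E := by positivity
            nlinarith
        _ ≤ 5 * L * σ * S := by
            rw [hL]
            have : 0 ≤ σ * S * (M * (1 + C)) * ((1 + C + C ^ 2) * K) := by positivity
            nlinarith
    · have hy := hY x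
      have hsx := abs_pos.2 hx
      -- The squared first derivative is too large by `σ` for the required bound; trading `|sin
      -- x|^γ` for `e x` turns that `σ` into another factor `σ * e x`.
      have hsplit : |Real.sin x| ^ (γ - 1) * |Real.sin x| ^ (γ - 1) ≤
          e x * |Real.sin x| ^ (γ - 2) := by
        rw [← Real.rpow_add hsx, show γ - 1 + (γ - 1) = γ + (γ - 2) by ring, Real.rpow_add hsx]
        exact mul_le_mul_of_nonneg_right
          (Real.rpow_le_rpow hsx.le (abs_sin_le_two_mul x) h0.le) (by positivity)
      set y := σ * e x with hydef
      set S := |Real.sin x| ^ (γ - 1) with hS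
      set T := |Real.sin x| ^ (γ - 2) with hT
      have hS0 : 0 ≤ S := by positivity
      have hT0 : 0 ≤ T := by positivity
      have hE := (Real.exp_pos (-c * y ^ 2)).le
      set E := Real.exp (-c * y ^ 2) with hEdef
      have hk : (1 + y) ^ 5 * E ≤ K := hmono hy (by omega)
      set Q := M * (1 + C) * ((1 + y) ^ 2 * E) with hQ
      have hQ0 : 0 ≤ Q := by positivity
      rw [hf₂]
      refine (norm_add_le _ _).trans ?_
      rw [norm_mul, norm_mul (_ * _) (_ * _), norm_mul (_ * _) (g₂ _)]
      calc _ ≤ C * σ * y * T * Q + C * σ * y * S * (C * σ * y * S * Q) :=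
            add_le_add (mul_le_mul (hle₂ x hx) (hgen hM₁ x) (norm_nonneg _) (by positivity))
              (mul_le_mul (hle₁ x hx) (mul_le_mul (hle₁ x hx) (hgen hM₂ x) (norm_nonneg _)
                (by positivity)) (by positivity) (by positivity))
        _ = σ * Q * (C * (y * T)) + σ * Q * (C ^ 2 * σ * y ^ 2 * (S * S)) := by ring
        _ ≤ σ * Q * (C * (y * T)) + σ * Q * (C ^ 2 * σ * y ^ 2 * (e x * T)) := by
            gcongr
        _ = σ * T * (M * (1 + C)) * ((C * y + C ^ 2 * y ^ 3) * ((1 + y) ^ 2 * E)) := by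
            rw [hQ, hydef]; ring
        _ ≤ σ * T * (M * (1 + C)) * ((1 + C + C ^ 2) * K) :=
            mul_le_mul_of_nonneg_left (cubic_mul_le hy hC hE hk) (by positivity)
        _ ≤ 5 * L * σ * T := by
            rw [hL]
            have : 0 ≤ σ * T * (M * (1 + C)) * ((1 + C + C ^ 2) * K) := by positivity
            nlinarith
  -- the pointwise bound
  have hpt : ∀ x, ‖g (s * G x)‖ ≤ L * (1 + (N * (2 * |Real.sin (x / 2)|)) ^ 2)⁻¹ := fun x => by
    have hy := hY x
    set X := N * (2 * |Real.sin (x / 2)|) with hX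
    have hX0 : 0 ≤ X := by positivity
    have hXy : X ^ γ = σ * e x := by
      rw [hX, Real.mul_rpow hN.le (by positivity)]
    set y := σ * e x with hydef
    have hX2 : X ^ 2 ≤ (1 + y) ^ n := by
      have e1 : X ^ 2 = y ^ (2 / γ) := by
        rw [← hXy, ← Real.rpow_mul hX0, mul_div_cancel₀ _ h0.ne', Real.rpow_two]
      rw [e1, ← Real.rpow_natCast]
      refine (Real.rpow_le_rpow hy (by linarith) (by positivity)).trans
        (Real.rpow_le_rpow_of_exponent_le (by linarith) ?_)
      rw [hn]
      push_cast
      linarith [Nat.le_ceil (2 / γ)]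
    rw [← div_eq_mul_inv, le_div_iff₀ (by positivity)]
    have h1y : (1 : ℝ) ≤ (1 + y) ^ n := one_le_pow₀ (by linarith)
    set E := Real.exp (-c * y ^ 2) with hEdef
    have hE : 0 ≤ E := (Real.exp_pos _).le
    calc _ ≤ M * (1 + C) * ((1 + y) ^ 2 * E) * (2 * (1 + y) ^ n) :=
          mul_le_mul (hgen hM x) (by linarith) (by positivity) (by positivity)
      _ = 2 * (M * (1 + C)) * ((1 + y) ^ (n + 2) * E) := by rw [pow_add]; ring
      _ ≤ 2 * (M * (1 + C)) * K := by
          refine mul_le_mul_of_nonneg_left (hK y hy) (by positivity)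
      _ ≤ L := by
          rw [hL]
          have : 0 ≤ M * (1 + C) * K := by positivity
          nlinarith
  refine hsing.exists_fourier_expansion h0 h1 hN (fun x => ?_) ?_
  · refine (hpt x).trans ?_
    have : (1 + (N * (2 * |Real.sin (x / 2)|)) ^ 2)⁻¹ ≤ 1 :=
      inv_le_one_of_one_le₀ (by nlinarith [sq_nonneg (N * (2 * |Real.sin (x / 2)|))])
    nlinarith
  · have hcont : Continuous fun x : ℝ => (1 + (N * (2 * |Real.sin (x / 2)|)) ^ 2)⁻¹ :=
      Continuous.inv₀ (by fun_prop) fun x => by positivity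
    calc ∫ x in (-Real.pi)..Real.pi, ‖g (s * G x)‖
        ≤ ∫ x in (-Real.pi)..Real.pi, L * (1 + (N * (2 * |Real.sin (x / 2)|)) ^ 2)⁻¹ :=
          intervalIntegral.integral_mono (by linarith [Real.pi_pos])
            ((hdg.comp hsG).norm.intervalIntegrable _ _)
            ((continuous_const.mul hcont).intervalIntegrable _ _) hpt
      _ = L * ∫ x in (-Real.pi)..Real.pi, (1 + (N * (2 * |Real.sin (x / 2)|)) ^ 2)⁻¹ :=
          intervalIntegral.integral_const_mul _ _
      _ ≤ L * (5 * N⁻¹) := mul_le_mul_of_nonneg_left (integral_inv_one_add_sq_sin_le hN) hL0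
      _ = 5 * L * N⁻¹ := by ring

/-! ### The real part of the symbols -/

theorem ofReal_mul_exp_cpow {r φ α : ℝ} (hr : 0 ≤ r) (hα : 0 < α) (h1 : -Real.pi < φ)
    (h2 : φ ≤ Real.pi) :
    ((r : ℂ) * Complex.exp (Complex.I * φ)) ^ (α : ℂ) =
      ((r ^ α : ℝ) : ℂ) * Complex.exp (Complex.I * (α * φ : ℝ)) := by
  rcases hr.eq_or_lt with rfl | hr
  · rw [Complex.ofReal_zero, zero_mul, Complex.zero_cpow (by exact_mod_cast hα.ne'),
      Real.zero_rpow hα.ne', Complex.ofReal_zero, zero_mul]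
  · have hne : ((r : ℂ) * Complex.exp (Complex.I * φ)) ≠ 0 :=
      mul_ne_zero (by exact_mod_cast hr.ne') (Complex.exp_ne_zero _)
    have hlog : Complex.log ((r : ℂ) * Complex.exp (Complex.I * φ)) =
        Real.log r + φ * Complex.I := by
      rw [Complex.log_ofReal_mul hr (Complex.exp_ne_zero _), mul_comm Complex.I,
        Complex.log_exp (by simpa using h1) (by simpa using h2)]
    rw [Complex.cpow_def_of_ne_zero hne, hlog, Real.rpow_def_of_pos hr, Complex.ofReal_exp,
      ← Complex.exp_add]
    congr 1
    push_cast; ring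

/-- For `0 ≤ θ ≤ 2π` this is a polar form with angle in `[-π/2, π/2]`, from which the principal
power is read off. -/
theorem one_sub_exp_eq (θ : ℝ) :
    1 - Complex.exp (Complex.I * θ) =
      ((2 * Real.sin (θ / 2) : ℝ) : ℂ) * Complex.exp (Complex.I * ((θ - Real.pi) / 2 : ℝ)) := by
  have e1 : Complex.exp (Complex.I * ((θ - Real.pi) / 2 : ℝ)) =
      Complex.exp (θ / 2 * Complex.I) * -Complex.I := by
    rw [← Complex.exp_neg_pi_div_two_mul_I, ← Complex.exp_add]
    congr 1
    push_cast; ring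
  have e2 : Complex.exp (Complex.I * θ) =
      Complex.exp (θ / 2 * Complex.I) * Complex.exp (θ / 2 * Complex.I) := by
    rw [← Complex.exp_add]; congr 1; ring
  have e3 : Complex.exp (-(θ / 2) * Complex.I) * Complex.exp (θ / 2 * Complex.I) = 1 := by
    rw [← Complex.exp_add, neg_mul, neg_add_cancel, Complex.exp_zero]
  rw [e1, e2]
  push_cast
  rw [Complex.sin]
  linear_combination (Complex.exp (-(θ / 2) * Complex.I) * Complex.exp (θ / 2 * Complex.I) -
    Complex.exp (θ / 2 * Complex.I) * Complex.exp (θ / 2 * Complex.I)) *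
      (Complex.I_mul_I) - e3

theorem re_expCpow {κ m : ℤ} {α x : ℝ} (hα : 0 < α) (h0 : 0 ≤ m * x) (h1 : m * x ≤ 2 * Real.pi) :
    (expCpow κ m α x).re =
      (2 * Real.sin (m * x / 2)) ^ α * Real.cos (κ * x + α * ((m * x - Real.pi) / 2)) := by
  have hpi := Real.pi_pos
  have e : Complex.I * ((m : ℝ) : ℂ) * x = Complex.I * ((m * x : ℝ) : ℂ) := by push_cast; ring
  have hs : 0 ≤ 2 * Real.sin (m * x / 2) :=
    mul_nonneg two_pos.le (Real.sin_nonneg_of_nonneg_of_le_pi (by linarith) (by linarith))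
  rw [expCpow, e, one_sub_exp_eq, ofReal_mul_exp_cpow hs hα (by linarith) (by linarith),
    mul_left_comm, ← Complex.exp_add, Complex.re_ofReal_mul]
  congr 1
  have e2 : Complex.I * ((κ : ℝ) : ℂ) * x + Complex.I * (α * ((m * x - Real.pi) / 2) : ℝ) =
      ((κ * x + α * ((m * x - Real.pi) / 2) : ℝ) : ℂ) * Complex.I := by push_cast; ring
  rw [e2, Complex.exp_ofReal_mul_I_re]

/-- Since `Re (1 - e^{imx}) ≥ 0`, the branch cut is avoided and the power commutes with conjugation;
hence the real part of the symbol is even. -/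
theorem expCpow_neg (κ m : ℤ) (α x : ℝ) :
    expCpow κ m α (-x) = (starRingEnd ℂ) (expCpow κ m α x) := by
  have e : ∀ n : ℤ, Complex.exp (Complex.I * (n : ℝ) * ((-x : ℝ) : ℂ)) =
      (starRingEnd ℂ) (Complex.exp (Complex.I * (n : ℝ) * x)) := fun n => by
    rw [← Complex.exp_conj]
    congr 1
    simp only [map_mul, Complex.conj_I, Complex.conj_ofReal]
    push_cast; ring
  have hre : (Complex.exp (Complex.I * (m : ℝ) * x)).re ≤ 1 :=
    (Complex.re_le_norm _).trans (norm_exp_I_mul _ _).le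
  have harg : (1 - Complex.exp (Complex.I * (m : ℝ) * x)).arg ≠ Real.pi := fun h => by
    have := (Complex.arg_eq_pi_iff.1 h).1
    simp only [Complex.sub_re, Complex.one_re] at this
    linarith
  have hc := Complex.cpow_conj _ (α : ℂ) harg
  rw [Complex.conj_ofReal] at hc
  rw [expCpow, expCpow, e, e, map_mul, hc, Complex.conj_conj, map_sub, map_one]

/-- With `x = π - 2y` the moduli of `1 - e^{ix}` and `1 - e^{2ix}` are `2 cos y` and `4 sin y cos
y`, so `(2 cos y)^α` factors out and `2^{-α}` cancels. What remains is a trigonometric inequality in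
`y`. -/
theorem re_coreSymbol {κ : ℤ} {α A B y : ℝ} (hα : 0 < α) (h0 : 0 ≤ y) (h1 : y ≤ Real.pi / 2) :
    (coreSymbol κ α A (B * 2 ^ (-α)) (Real.pi - 2 * y)).re = (2 * Real.cos y) ^ α *
      (A * Real.cos (κ * (Real.pi - 2 * y) - α * y) +
        B * Real.sin y ^ α * Real.cos (κ * (Real.pi - 2 * y) + α * (Real.pi / 2 - 2 * y))) := by
  have hpi := Real.pi_pos
  have hs : 0 ≤ Real.sin y := Real.sin_nonneg_of_nonneg_of_le_pi h0 (by linarith)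
  have hc : 0 ≤ Real.cos y := Real.cos_nonneg_of_neg_pi_div_two_le_of_le (by linarith) h1
  rw [coreSymbol, Complex.add_re, Complex.re_ofReal_mul, Complex.re_ofReal_mul,
    re_expCpow hα (by push_cast; linarith) (by push_cast; linarith),
    re_expCpow hα (by push_cast; linarith) (by push_cast; linarith)]
  have e1 : Real.sin (((1 : ℤ) : ℝ) * (Real.pi - 2 * y) / 2) = Real.cos y := by
    rw [← Real.sin_pi_div_two_sub]; congr 1; push_cast; ring
  have e2 : Real.sin (((2 : ℤ) : ℝ) * (Real.pi - 2 * y) / 2) = 2 * Real.sin y * Real.cos y := by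
    rw [← Real.sin_two_mul, ← Real.sin_pi_sub]; congr 1; push_cast; ring
  have e3 : (κ : ℝ) * (Real.pi - 2 * y) + α * ((((1 : ℤ) : ℝ) * (Real.pi - 2 * y) - Real.pi) / 2) =
      κ * (Real.pi - 2 * y) - α * y := by push_cast; ring
  have e4 : (κ : ℝ) * (Real.pi - 2 * y) + α * ((((2 : ℤ) : ℝ) * (Real.pi - 2 * y) - Real.pi) / 2) =
      κ * (Real.pi - 2 * y) + α * (Real.pi / 2 - 2 * y) := by push_cast; ring
  have e5 : (2 * (2 * Real.sin y * Real.cos y)) ^ α =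
      2 ^ α * Real.sin y ^ α * (2 * Real.cos y) ^ α := by
    rw [← Real.mul_rpow two_pos.le hs, ← Real.mul_rpow (by positivity) (by positivity)]
    congr 1; ring
  have e6 : (2 : ℝ) ^ (-α) * 2 ^ α = 1 := by
    rw [← Real.rpow_add two_pos, neg_add_cancel, Real.rpow_zero]
  rw [e1, e2, e3, e4, e5]
  linear_combination B * Real.sin y ^ α * (2 * Real.cos y) ^ α *
    Real.cos (κ * (Real.pi - 2 * y) + α * (Real.pi / 2 - 2 * y)) * e6

/-- By symmetry and periodicity it suffices to bound the real part on `[0, π]`. -/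
theorem re_coreSymbol_le {κ : ℤ} {α A B c : ℝ} (hα : 0 < α)
    (h : ∀ y, 0 ≤ y → y ≤ Real.pi / 2 →
      c ≤ -(A * Real.cos (κ * (Real.pi - 2 * y) - α * y) +
        B * Real.sin y ^ α * Real.cos (κ * (Real.pi - 2 * y) + α * (Real.pi / 2 - 2 * y)))) (x : ℝ) :
    (coreSymbol κ α A (B * 2 ^ (-α)) x).re ≤ -c * (2 * |Real.sin (x / 2)|) ^ α := by
  have hpi := Real.pi_pos
  have key : ∀ x, 0 ≤ x → x ≤ Real.pi →
      (coreSymbol κ α A (B * 2 ^ (-α)) x).re ≤ -c * (2 * |Real.sin (x / 2)|) ^ α := by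
    intro x hx0 hx1
    have h1 : 0 ≤ (Real.pi - x) / 2 := by linarith
    have h2 : (Real.pi - x) / 2 ≤ Real.pi / 2 := by linarith
    have e := re_coreSymbol (κ := κ) (A := A) (B := B) hα h1 h2
    have hy := h _ h1 h2
    have ex : Real.pi - 2 * ((Real.pi - x) / 2) = x := by ring
    rw [ex] at e hy
    have ec : Real.cos ((Real.pi - x) / 2) = |Real.sin (x / 2)| := by
      rw [abs_of_nonneg (Real.sin_nonneg_of_nonneg_of_le_pi (by linarith) (by linarith)),
        ← Real.cos_pi_div_two_sub]
      congr 1; ring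
    rw [e, ec]
    have hE : 0 ≤ (2 * |Real.sin (x / 2)|) ^ α := by positivity
    nlinarith [mul_le_mul_of_nonneg_left hy hE]
  have key' : ∀ x, -Real.pi < x → x ≤ Real.pi →
      (coreSymbol κ α A (B * 2 ^ (-α)) x).re ≤ -c * (2 * |Real.sin (x / 2)|) ^ α := by
    intro x hx0 hx1
    rcases le_total 0 x with hx | hx
    · exact key x hx hx1
    · have := key (-x) (by linarith) (by linarith)
      rw [coreSymbol, expCpow_neg, expCpow_neg, neg_div, Real.sin_neg, abs_neg] at this
      simpa [coreSymbol] using this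
  set F : ℝ → ℝ := fun x =>
    (coreSymbol κ α A (B * 2 ^ (-α)) x).re + c * (2 * |Real.sin (x / 2)|) ^ α with hF
  have hper : Function.Periodic F (2 * Real.pi) := fun x => by
    simp only [hF, periodic_coreSymbol κ α A _ x]
    rw [add_div, mul_div_cancel_left₀ _ two_ne_zero, Real.sin_add_pi, abs_neg]
  obtain ⟨y, hy, hxy⟩ := hper.exists_mem_Ioc (by positivity) x (-Real.pi)
  have := key' y hy.1 (by linarith [hy.2])
  have hFx : F x ≤ 0 := by rw [hxy]; simp only [hF]; linarith
  simp only [hF] at hFx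
  linarith

/-- The real part of the symbol for `0 < α < 1`. -/
theorem exists_re_bound_of_lt_one {α : ℝ} (h0 : 0 < α) (h1 : α < 1) : ∃ c : ℝ, 0 < c ∧
    ∀ x, (coreSymbol 0 α (-2) (1 * 2 ^ (-α)) x).re ≤ -c * (2 * |Real.sin (x / 2)|) ^ α := by
  have hpi := Real.pi_pos
  have hb : α * Real.pi / 2 < Real.pi / 2 := by nlinarith
  have hb0 : 0 < α * Real.pi / 2 := by positivity
  -- The bracket will be at least `cos u (1 - sin u)` with `u = α y`; the witness is its value at
  -- the largest `u`.
  refine ⟨Real.cos (α * Real.pi / 2) * (1 - Real.sin (α * Real.pi / 2)), mul_pos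
    (Real.cos_pos_of_mem_Ioo ⟨by linarith, hb⟩) (sub_pos.2 ?_),
    re_coreSymbol_le h0 fun y hy0 hy1 => ?_⟩
  · rw [← Real.sin_pi_div_two]
    exact Real.sin_lt_sin_of_lt_of_le_pi_div_two (by linarith) le_rfl hb
  · set u := α * y with hu
    set w := α * (Real.pi / 2 - y) with hw
    have hu0 : 0 ≤ u := by positivity
    have hw0 : 0 ≤ w := mul_nonneg h0.le (by linarith)
    have huw : u + w = α * Real.pi / 2 := by rw [hu, hw]; ring
    have e1 : ((0 : ℤ) : ℝ) * (Real.pi - 2 * y) - α * y = -u := by push_cast; ring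
    have e2 : ((0 : ℤ) : ℝ) * (Real.pi - 2 * y) + α * (Real.pi / 2 - 2 * y) = w - u := by
      rw [hu, hw]; push_cast; ring
    rw [e1, e2, Real.cos_neg]
    have hcu : Real.cos (α * Real.pi / 2) ≤ Real.cos u :=
      Real.cos_le_cos_of_nonneg_of_le_pi hu0 (by linarith) (by linarith)
    have hsu : Real.sin u ≤ Real.sin (α * Real.pi / 2) :=
      Real.sin_le_sin_of_le_of_le_pi_div_two (by linarith) hb.le (by linarith)
    have hsu0 : 0 ≤ Real.sin u := Real.sin_nonneg_of_nonneg_of_le_pi hu0 (by linarith)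
    have hsw : Real.sin w ≤ Real.cos u := by
      rw [← Real.sin_pi_div_two_sub]
      exact Real.sin_le_sin_of_le_of_le_pi_div_two (by linarith) (by linarith) (by linarith)
    have hcu0 : 0 < Real.cos (α * Real.pi / 2) := Real.cos_pos_of_mem_Ioo ⟨by linarith, hb⟩
    -- Expand `cos (w - u)` and use `cos w ≤ 1` and `sin w ≤ cos u`, the latter because `u + w <
    -- π/2`.
    have hcwu : Real.cos (w - u) ≤ Real.cos u * (1 + Real.sin u) := by
      rw [Real.cos_sub]
      nlinarith [Real.cos_le_one w, mul_le_mul_of_nonneg_right hsw hsu0]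
    have hcwu0 : 0 ≤ Real.cos (w - u) :=
      Real.cos_nonneg_of_neg_pi_div_two_le_of_le (by linarith) (by linarith)
    have hsy : Real.sin y ^ α ≤ 1 :=
      Real.rpow_le_one (Real.sin_nonneg_of_nonneg_of_le_pi hy0 (by linarith))
        (Real.sin_le_one _) h0.le
    have hprod : Real.sin y ^ α * Real.cos (w - u) ≤ Real.cos u * (1 + Real.sin u) :=
      (mul_le_of_le_one_left hcwu0 hsy).trans hcwu
    have hsin1 : Real.sin (α * Real.pi / 2) ≤ 1 := Real.sin_le_one _
    have : Real.cos (α * Real.pi / 2) * (1 - Real.sin (α * Real.pi / 2)) ≤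
        Real.cos u * (1 - Real.sin u) :=
      mul_le_mul hcu (by linarith) (by linarith) (by linarith)
    linarith

/-- The real part of the symbol for `1 < α < 2`. -/
theorem exists_re_bound_of_one_lt {α : ℝ} (h1 : 1 < α) (h2 : α < 2) : ∃ c : ℝ, 0 < c ∧
    ∀ x, (coreSymbol (-1) α (2 - 2 / α) ((1 - (2 - 2 / α)) * 2 ^ (-α)) x).re ≤
      -c * (2 * |Real.sin (x / 2)|) ^ α := by
  have hpi := Real.pi_pos
  have h0 : 0 < α := by linarith
  set β : ℝ := 2 - α with hβ
  have hβ0 : 0 < β := by linarith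
  have hβ1 : β < 1 := by linarith
  set a : ℝ := 2 - 2 / α with ha
  have ha0 : 0 < a := by
    rw [ha, sub_pos, div_lt_iff₀ h0]; linarith
  have ha1 : 0 ≤ 1 - a := by
    rw [ha, show 1 - (2 - 2 / α) = (2 - α) / α by field_simp; ring]
    exact div_nonneg hβ0.le h0.le
  -- The value of `a` enters through this identity: it measures the possibly harmful second term as
  -- a multiple of `a`.
  have hab : (1 - a) * (1 - β) = a * (β / 2) := by
    rw [ha, hβ]; field_simp; ring
  have hcpos : 0 < Real.cos (β * Real.pi / 2) :=
    Real.cos_pos_of_mem_Ioo ⟨by nlinarith, by nlinarith⟩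
  refine ⟨min (a * Real.cos (β * Real.pi / 2)) (a / 10), by positivity,
    re_coreSymbol_le h0 fun y hy0 hy1 => ?_⟩
  have e1 : Real.cos (((-1 : ℤ) : ℝ) * (Real.pi - 2 * y) - α * y) = -Real.cos (β * y) := by
    rw [← Real.cos_sub_pi]
    congr 1; rw [hβ]; push_cast; ring
  have e2 : Real.cos (((-1 : ℤ) : ℝ) * (Real.pi - 2 * y) + α * (Real.pi / 2 - 2 * y)) =
      Real.sin ((1 - β) * (Real.pi / 2 - 2 * y)) := by
    rw [← Real.cos_pi_div_two_sub, ← Real.cos_neg]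
    congr 1; rw [hβ]; push_cast; ring
  rw [e1, e2]
  have hsy0 : 0 ≤ Real.sin y := Real.sin_nonneg_of_nonneg_of_le_pi hy0 (by linarith)
  have hsyα : 0 ≤ Real.sin y ^ α := Real.rpow_nonneg hsy0 _
  -- For `y ≥ π/4` the second term has the favourable sign. For `y ≤ π/4` it is at most `0.568 a`,
  -- against at least `0.7 a` from the first term.
  rcases le_total (Real.pi / 4) y with hy | hy
  · have hs : Real.sin ((1 - β) * (Real.pi / 2 - 2 * y)) ≤ 0 := by
      refine Real.sin_nonpos_of_nonpos_of_neg_pi_le ?_ ?_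
      · exact mul_nonpos_of_nonneg_of_nonpos (by linarith) (by linarith)
      · nlinarith
    have hc : Real.cos (β * Real.pi / 2) ≤ Real.cos (β * y) :=
      Real.cos_le_cos_of_nonneg_of_le_pi (by positivity) (by nlinarith) (by nlinarith)
    refine (min_le_left _ _).trans ?_
    nlinarith [mul_le_mul_of_nonneg_left hc ha0.le,
      mul_nonneg (mul_nonneg ha1 hsyα) (neg_nonneg.2 hs)]
  · have hcos : (7 : ℝ) / 10 ≤ Real.cos (β * y) := by
      have : Real.cos (Real.pi / 4) ≤ Real.cos (β * y) :=
        Real.cos_le_cos_of_nonneg_of_le_pi (by positivity) (by linarith) (by nlinarith)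
      rw [Real.cos_pi_div_four] at this
      have h14 : (1.4 : ℝ) ≤ √2 := Real.le_sqrt_of_sq_le (by norm_num)
      linarith
    have hsin4 : Real.sin y ≤ 71 / 100 := by
      have : Real.sin y ≤ Real.sin (Real.pi / 4) :=
        Real.sin_le_sin_of_le_of_le_pi_div_two (by linarith) (by linarith) hy
      rw [Real.sin_pi_div_four] at this
      have h14 : √2 ≤ (1.42 : ℝ) := Real.sqrt_le_iff.2 ⟨by norm_num, by norm_num⟩
      linarith
    have hsα : Real.sin y ^ α ≤ 71 / 100 := by
      rcases hsy0.eq_or_lt with h | h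
      · rw [← h, Real.zero_rpow h0.ne']; norm_num
      · refine le_trans ?_ hsin4
        simpa using Real.rpow_le_rpow_of_exponent_ge h (Real.sin_le_one y) h1.le
    have hang : 0 ≤ (1 - β) * (Real.pi / 2 - 2 * y) := mul_nonneg (by linarith) (by linarith)
    have hsin : Real.sin ((1 - β) * (Real.pi / 2 - 2 * y)) ≤ (1 - β) * (8 / 5) := by
      refine (Real.sin_le hang).trans (mul_le_mul_of_nonneg_left ?_ (by linarith))
      linarith [Real.pi_lt_d2]
    have hprod : (1 - a) * Real.sin y ^ α * Real.sin ((1 - β) * (Real.pi / 2 - 2 * y)) ≤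
        a * (β / 2) * (71 / 100 * (8 / 5)) := by
      rw [← hab]
      calc _ ≤ (1 - a) * (71 / 100) * ((1 - β) * (8 / 5)) :=
            mul_le_mul (mul_le_mul_of_nonneg_left hsα ha1) hsin
              (Real.sin_nonneg_of_nonneg_of_le_pi hang (by nlinarith)) (by positivity)
        _ = _ := by ring
    refine (min_le_right _ _).trans ?_
    nlinarith [mul_le_mul_of_nonneg_left hcos ha0.le, mul_le_mul_of_nonneg_left hβ1.le ha0.le]

/-! ### The Grünwald symbols are multipliers -/

theorem exists_translation_volume (c : ℝ) : ∃ S : L1 volume →L[ℂ] L1 volume, ‖S‖ ≤ 1 ∧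
    HasSymbol S fun k => Complex.exp (Complex.I * k * c) :=
  ⟨translate c, norm_translate_le c, hasSymbol_translate c⟩

theorem exists_translation_halfLine (c : ℝ) (hc : 0 ≤ c) :
    ∃ S : L1 halfLine →L[ℂ] L1 halfLine, ‖S‖ ≤ 1 ∧
      HasSymbol S fun k => Complex.exp (Complex.I * k * c) :=
  ⟨translateHalf c, norm_translateHalf_le c, hasSymbol_translateHalf hc⟩

theorem isL1Multiplier_exp_volume (c : ℝ) :
    IsL1Multiplier volume fun k => Complex.exp (Complex.I * k * c) :=
  (hasSymbol_translate c).isL1Multiplier (by fun_prop)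

/-- Write the power as `(1 - z)(1 - z)^{α-1}`, whose second exponent lies in `(0, 1)`; at `1 - z =
0` both sides vanish. -/
theorem isL1Multiplier_one_sub_exp_cpow_of_one_lt {α : ℝ} (h1 : 1 < α) (h2 : α < 2) {h : ℝ}
    (hh : 0 ≤ h) :
    IsL1Multiplier volume fun k => (1 - Complex.exp (Complex.I * k * h)) ^ (α : ℂ) := by
  have hm := isL1Multiplier_one_sub_exp_cpow (fun c _ => exists_translation_volume c)
    (α := α - 1) (by linarith) (by linarith) hh
  have hm' := ((isL1Multiplier_const 1).add
    ((isL1Multiplier_const (-1)).mul (isL1Multiplier_exp_volume h))).mul hm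
  convert! hm' using 2 with k
  rw [neg_one_mul, ← sub_eq_add_neg]
  set z := 1 - Complex.exp (Complex.I * k * h) with hz
  by_cases h0 : z = 0
  · rw [h0, zero_mul, Complex.zero_cpow (by exact_mod_cast (by linarith : α ≠ 0))]
  · rw [Complex.ofReal_sub, Complex.ofReal_one, Complex.cpow_sub _ _ h0, Complex.cpow_one,
      mul_div_cancel₀ _ h0]

theorem isL1Multiplier_grunwaldSymbol {μ : Measure ℝ} {α p h : ℝ} (q : ℕ)
    (h1 : IsL1Multiplier μ fun k => Complex.exp (-Complex.I * p * k * h))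
    (h2 : IsL1Multiplier μ fun k => (1 - Complex.exp (Complex.I * k * h)) ^ (α : ℂ)) :
    IsL1Multiplier μ (grunwaldSymbol α q p h) :=
  ((isL1Multiplier_const _).mul h1).mul h2

theorem isL1Multiplier_mixedSymbol {μ : Measure ℝ} {α p₁ p₂ h : ℝ} (q : ℕ) (a : ℝ)
    (h1 : IsL1Multiplier μ (grunwaldSymbol α q p₁ h))
    (h2 : IsL1Multiplier μ (grunwaldSymbol α q p₂ (2 * h))) :
    IsL1Multiplier μ (mixedSymbol α q a p₁ p₂ h) :=
  ((isL1Multiplier_const _).mul h1).add ((isL1Multiplier_const _).mul h2)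

theorem isL1Multiplier_mixedSymbol_of_lt_one {μ : Measure ℝ}
    (hμ : ∀ c : ℝ, 0 ≤ c → ∃ S : L1 μ →L[ℂ] L1 μ, ‖S‖ ≤ 1 ∧
      HasSymbol S fun k => Complex.exp (Complex.I * k * c))
    {α : ℝ} (h0 : 0 < α) (h1 : α < 1) (a : ℝ) {h : ℝ} (hh : 0 < h) :
    IsL1Multiplier μ (mixedSymbol α 0 a 0 0 h) := by
  have e : ∀ h : ℝ, IsL1Multiplier μ fun k =>
      Complex.exp (-Complex.I * (0 : ℝ) * (k : ℂ) * (h : ℂ)) := fun h => by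
    simpa using isL1Multiplier_const (μ := μ) 1
  exact isL1Multiplier_mixedSymbol 0 a
    (isL1Multiplier_grunwaldSymbol 0 (e h) (isL1Multiplier_one_sub_exp_cpow hμ h0 h1 hh.le))
    (isL1Multiplier_grunwaldSymbol 0 (e (2 * h))
      (isL1Multiplier_one_sub_exp_cpow hμ h0 h1 (by positivity)))

theorem isL1Multiplier_mixedSymbol_of_one_lt {α : ℝ} (h1 : 1 < α) (h2 : α < 2) (a p₁ p₂ : ℝ)
    {h : ℝ} (hh : 0 < h) : IsL1Multiplier volume (mixedSymbol α 1 a p₁ p₂ h) := by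
  have e : ∀ p h : ℝ, IsL1Multiplier volume fun k =>
      Complex.exp (-Complex.I * p * (k : ℂ) * (h : ℂ)) := fun p h => by
    convert! isL1Multiplier_exp_volume (-(p * h)) using 3 with k
    push_cast; ring
  exact isL1Multiplier_mixedSymbol 1 a
    (isL1Multiplier_grunwaldSymbol 1 (e p₁ h)
      (isL1Multiplier_one_sub_exp_cpow_of_one_lt h1 h2 hh.le))
    (isL1Multiplier_grunwaldSymbol 1 (e p₂ (2 * h))
      (isL1Multiplier_one_sub_exp_cpow_of_one_lt h1 h2 (by positivity)))

theorem mixedSymbol_zero_eq (α : ℝ) {h : ℝ} (hh : 0 < h) (k : ℝ) :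
    mixedSymbol α 0 2 0 0 h k =
      ((h ^ (-α) : ℝ) : ℂ) * coreSymbol 0 α (-2) (1 * 2 ^ (-α)) (h * k) := by
  rw [mixedSymbol, grunwaldSymbol, grunwaldSymbol, coreSymbol, expCpow, expCpow,
    Real.mul_rpow two_pos.le hh.le]
  have e1 : Complex.I * ((1 : ℤ) : ℝ) * ((h * k : ℝ) : ℂ) = Complex.I * k * h := by
    push_cast; ring
  have e2 : Complex.I * ((2 : ℤ) : ℝ) * ((h * k : ℝ) : ℂ) = Complex.I * k * (2 * h : ℝ) := by
    push_cast; ring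
  rw [e1, e2]
  simp only [Int.cast_zero, Complex.ofReal_zero, mul_zero, zero_mul, Complex.exp_zero]
  push_cast
  ring

/-- The shifts match, `1 · h = ½ · 2h`, so both terms carry the same factor `e^{-ikh}`, which is `κ
= -1`. -/
theorem mixedSymbol_one_eq (α a : ℝ) {h : ℝ} (hh : 0 < h) (k : ℝ) :
    mixedSymbol α 1 a 1 (1 / 2) h k =
      ((h ^ (-α) : ℝ) : ℂ) * coreSymbol (-1) α a ((1 - a) * 2 ^ (-α)) (h * k) := by
  rw [mixedSymbol, grunwaldSymbol, grunwaldSymbol, coreSymbol, expCpow, expCpow,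
    Real.mul_rpow two_pos.le hh.le]
  have e1 : Complex.I * ((1 : ℤ) : ℝ) * ((h * k : ℝ) : ℂ) = Complex.I * k * h := by
    push_cast; ring
  have e2 : Complex.I * ((2 : ℤ) : ℝ) * ((h * k : ℝ) : ℂ) = Complex.I * k * (2 * h : ℝ) := by
    push_cast; ring
  have e3 : Complex.I * ((-1 : ℤ) : ℝ) * ((h * k : ℝ) : ℂ) = -Complex.I * (1 : ℝ) * k * h := by
    push_cast; ring
  have e4 : -Complex.I * ((1 / 2 : ℝ) : ℂ) * k * ((2 * h : ℝ) : ℂ) =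
      -Complex.I * (1 : ℝ) * k * h := by
    push_cast; ring
  rw [e1, e2, e3, e4]
  push_cast
  ring

/-! ### Uniform bounds -/

/-- The character `e^{inx}` at `x = hk` is the symbol of translation by `nh`; the resulting norm
bound does not involve `h`. -/
theorem hasSymbol_fourier_series {f : ℝ → ℂ} {b : ℤ → ℂ} (hb : Summable fun n => ‖b n‖)
    (hf : ∀ x : ℝ, HasSum (fun n : ℤ => b n * Complex.exp (Complex.I * x * n)) (f x)) (h : ℝ) :
    ∃ S : L1 volume →L[ℂ] L1 volume, HasSymbol S (fun k => f (h * k)) ∧ ‖S‖ ≤ ∑' n, ‖b n‖ := by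
  refine ⟨_, hasSymbol_tsum (S := fun n : ℤ => translate (n * h))
    (fun n => hasSymbol_translate _) (fun n => norm_translate_le _) hb fun k => ?_⟩
  convert! hf (h * k) using 4 with n
  push_cast; ring

/-- The symbols `φ_h` are rescalings of a single symbol on the circle whose real part is at most
`-c |1 - e^{ix}|^α`. -/
structure IsDissipativeScaling (α : ℝ) (φ : ℝ → ℝ → ℂ) : Prop where
  multiplier : ∀ h, 0 < h → IsL1Multiplier volume (φ h)
  exists_core : ∃ (κ : ℤ) (A B c : ℝ), 0 < c ∧
    (∀ x, (coreSymbol κ α A B x).re ≤ -c * (2 * |Real.sin (x / 2)|) ^ α) ∧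
    ∀ h, 0 < h → ∀ k, φ h k = ((h ^ (-α) : ℝ) : ℂ) * coreSymbol κ α A B (h * k)

section uniform

variable {α : ℝ} {φ : ℝ → ℝ → ℂ}

/-- For `g` entire with `g`, `g'`, `g''` of size `O((1 + |z|) e^{Re z})`, the functions `g (t φ_h)`
are symbols of uniformly bounded operators. -/
theorem IsDissipativeScaling.exists_uniform_bound (H : IsDissipativeScaling α φ) (h0 : 0 < α)
    (h2 : α < 2) {g g₁ g₂ : ℂ → ℂ} {M : ℝ} (hg : ∀ z, HasDerivAt g (g₁ z) z)
    (hg₁ : ∀ z, HasDerivAt g₁ (g₂ z) z) (hg₂ : Continuous g₂)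
    (hM : ∀ z, ‖g z‖ ≤ M * ((1 + ‖z‖) * Real.exp z.re))
    (hM₁ : ∀ z, ‖g₁ z‖ ≤ M * ((1 + ‖z‖) * Real.exp z.re))
    (hM₂ : ∀ z, ‖g₂ z‖ ≤ M * ((1 + ‖z‖) * Real.exp z.re)) :
    ∃ K : ℝ, ∀ h t : ℝ, 0 < h → 0 < t → ∃ S : L1 volume →L[ℂ] L1 volume,
      HasSymbol S (fun k => g (t * φ h k)) ∧ ‖S‖ ≤ K := by
  obtain ⟨κ, A, B, c, hc, hre, hφ⟩ := H.exists_core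
  have hα : 2 * (α / 2) = α := by ring
  have hpow : ∀ x, (2 * |Real.sin (x / 2)|) ^ α = ((2 * |Real.sin (x / 2)|) ^ (α / 2)) ^ 2 :=
    fun x => by
      rw [← Real.rpow_natCast, ← Real.rpow_mul (by positivity)]
      congr 1; push_cast; ring
  obtain ⟨K, hK⟩ := exists_uniform_fourier_expansion (γ := α / 2) (κ := κ) (A := A) (B := B)
    (by linarith) (by linarith) hc (fun x => by rw [hα, ← hpow]; exact hre x) hg hg₁ hg₂ hM hM₁ hM₂
  rw [hα] at hK
  refine ⟨K, fun h t hh ht => ?_⟩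
  -- Both parameters enter only through `s = t h^{-α}` and the dilation by `h`, so uniformity in `s`
  -- suffices.
  obtain ⟨b, hb, hbK, hf⟩ := hK (t * h ^ (-α)) (mul_pos ht (Real.rpow_pos_of_pos hh _))
  obtain ⟨S, hS, hSb⟩ := hasSymbol_fourier_series hb hf h
  refine ⟨S, ?_, hSb.trans hbK⟩
  convert! hS using 3 with k
  rw [hφ h hh]
  push_cast; ring

theorem IsDissipativeScaling.uniformlyBounded (H : IsDissipativeScaling α φ) (h0 : 0 < α)
    (h2 : α < 2) : UniformlyBounded volume φ := by
  have hb : ∀ z : ℂ, ‖Complex.exp z‖ ≤ 1 * ((1 + ‖z‖) * Real.exp z.re) := fun z => by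
    rw [Complex.norm_exp, one_mul]
    exact le_mul_of_one_le_left (Real.exp_pos _).le (by linarith [norm_nonneg z])
  obtain ⟨K, hK⟩ := H.exists_uniform_bound h0 h2 Complex.hasDerivAt_exp Complex.hasDerivAt_exp
    Complex.continuous_exp hb hb hb
  -- The `1` covers `t = 0`, where the operator is the identity and the expansion for `s > 0` does
  -- not apply.
  refine ⟨max K 1, fun h t hh ht => ?_⟩
  rcases ht.eq_or_lt with rfl | ht
  · rw [(multiplierOp_exp (H.multiplier h hh) 0).2, Complex.ofReal_zero, zero_smul,
      NormedSpace.exp_zero]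
    exact ContinuousLinearMap.norm_id_le.trans (le_max_right _ _)
  · obtain ⟨S, hS, hSK⟩ := hK h t hh ht
    rw [hS.multiplierOp_eq (multiplierOp_exp (H.multiplier h hh) t).1.1]
    exact hSK.trans (le_max_left _ _)

theorem IsDissipativeScaling.uniformlyAnalytic (H : IsDissipativeScaling α φ) (h0 : 0 < α)
    (h2 : α < 2) : UniformlyAnalytic volume φ := by
  -- Differentiating `(w + z) e^z` replaces `w` by `w + 1`; the cases `w = 0, 1, 2` give `g(z) = z
  -- e^z` and its two derivatives.
  have hd : ∀ (w z : ℂ), HasDerivAt (fun z => (w + z) * Complex.exp z)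
      ((w + 1 + z) * Complex.exp z) z := fun w z => by
    refine (((hasDerivAt_id z).const_add w).mul (Complex.hasDerivAt_exp z)).congr_deriv ?_
    simp only [id]
    ring
  have hb : ∀ (w : ℂ), ‖w‖ ≤ 2 → ∀ z : ℂ,
      ‖(w + z) * Complex.exp z‖ ≤ 2 * ((1 + ‖z‖) * Real.exp z.re) := fun w hw z => by
    rw [norm_mul, Complex.norm_exp, ← mul_assoc]
    refine mul_le_mul_of_nonneg_right ?_ (Real.exp_pos _).le
    linarith [norm_add_le w z, norm_nonneg z]
  obtain ⟨K, hK⟩ := H.exists_uniform_bound h0 h2 (hd 0) (hd (0 + 1)) (by fun_prop)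
    (hb 0 (by simp)) (hb (0 + 1) (by simp)) (hb (0 + 1 + 1) (by norm_num))
  refine ⟨max K 1, by positivity, fun h t hh ht => ?_⟩
  have hm := (H.multiplier h hh).mul (multiplierOp_exp (H.multiplier h hh) t).1
  refine ⟨hm, ?_⟩
  obtain ⟨S, hS, hSK⟩ := hK h t hh ht
  have hS' : HasSymbol (((t⁻¹ : ℝ) : ℂ) • S) fun k => φ h k * Complex.exp (t * φ h k) := by
    convert! hS.smul ((t⁻¹ : ℝ) : ℂ) using 2 with k
    have : (t : ℂ) ≠ 0 := by exact_mod_cast ht.ne'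
    push_cast
    field_simp
    ring
  rw [hS'.multiplierOp_eq hm.1, norm_smul, Complex.norm_real,
    Real.norm_of_nonneg (inv_nonneg.2 ht.le), mul_comm]
  exact mul_le_mul_of_nonneg_right (hSK.trans (le_max_left _ _)) (inv_nonneg.2 ht.le)

theorem UniformlyBounded.halfLine (H : UniformlyBounded volume φ)
    (h1 : ∀ h, 0 < h → IsL1Multiplier volume (φ h))
    (h2 : ∀ h, 0 < h → IsL1Multiplier halfLine (φ h)) : UniformlyBounded halfLine φ := by
  obtain ⟨K, hK⟩ := H
  exact ⟨K, fun h t hh ht => (norm_multiplierOp_halfLine_le (multiplierOp_exp (h2 h hh) t).1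
    (multiplierOp_exp (h1 h hh) t).1).trans (hK h t hh ht)⟩

theorem UniformlyAnalytic.halfLine (H : UniformlyAnalytic volume φ)
    (h2 : ∀ h, 0 < h → IsL1Multiplier halfLine (φ h)) : UniformlyAnalytic halfLine φ := by
  obtain ⟨M, hM0, hM⟩ := H
  refine ⟨M, hM0, fun h t hh ht => ?_⟩
  have hm := (h2 h hh).mul (multiplierOp_exp (h2 h hh) t).1
  exact ⟨hm, (norm_multiplierOp_halfLine_le hm (hM h t hh ht).1).trans (hM h t hh ht).2⟩

theorem isDissipativeScaling_of_lt_one (h0 : 0 < α) (h1 : α < 1) :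
    IsDissipativeScaling α (mixedSymbol α 0 2 0 0) := by
  obtain ⟨c, hc, hre⟩ := exists_re_bound_of_lt_one h0 h1
  exact ⟨fun h hh => isL1Multiplier_mixedSymbol_of_lt_one (fun c _ => exists_translation_volume c)
    h0 h1 2 hh, 0, -2, _, c, hc, hre, fun h hh k => mixedSymbol_zero_eq α hh k⟩

theorem isDissipativeScaling_of_one_lt (h1 : 1 < α) (h2 : α < 2) :
    IsDissipativeScaling α (mixedSymbol α 1 (2 - 2 / α) 1 (1 / 2)) := by
  obtain ⟨c, hc, hre⟩ := exists_re_bound_of_one_lt h1 h2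
  exact ⟨fun h hh => isL1Multiplier_mixedSymbol_of_one_lt h1 h2 _ _ _ hh, -1, _, _, c, hc, hre,
    fun h hh k => mixedSymbol_one_eq α _ hh k⟩

end uniform

end

end Grunwald

theorem theorem4p5 (α : ℝ) :
    (0 < α → α < 1 →
      Grunwald.GenerateSemigroups Grunwald.halfLine (Grunwald.mixedSymbol α 0 2 0 0) ∧
      Grunwald.UniformlyBounded Grunwald.halfLine (Grunwald.mixedSymbol α 0 2 0 0) ∧
      Grunwald.UniformlyAnalytic Grunwald.halfLine (Grunwald.mixedSymbol α 0 2 0 0)) ∧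
    (1 < α → α < 2 →
      Grunwald.GenerateSemigroups MeasureTheory.volume
        (Grunwald.mixedSymbol α 1 (2 - 2 / α) 1 (1 / 2)) ∧
      Grunwald.UniformlyBounded MeasureTheory.volume
        (Grunwald.mixedSymbol α 1 (2 - 2 / α) 1 (1 / 2)) ∧
      Grunwald.UniformlyAnalytic MeasureTheory.volume
        (Grunwald.mixedSymbol α 1 (2 - 2 / α) 1 (1 / 2))) := by
  refine ⟨fun h0 h1 => ?_, fun h1 h2 => ?_⟩
  · have H := Grunwald.isDissipativeScaling_of_lt_one h0 h1
    have hm : ∀ h, 0 < h →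
        Grunwald.IsL1Multiplier Grunwald.halfLine (Grunwald.mixedSymbol α 0 2 0 0 h) :=
      fun h hh => Grunwald.isL1Multiplier_mixedSymbol_of_lt_one
        Grunwald.exists_translation_halfLine h0 h1 2 hh
    exact ⟨Grunwald.generateSemigroups_of_isL1Multiplier hm,
      (H.uniformlyBounded h0 (by linarith)).halfLine H.multiplier hm,
      (H.uniformlyAnalytic h0 (by linarith)).halfLine hm⟩
  · have H := Grunwald.isDissipativeScaling_of_one_lt h1 h2
    exact ⟨Grunwald.generateSemigroups_of_isL1Multiplier H.multiplier,
      H.uniformlyBounded (by linarith) h2, H.uniformlyAnalytic (by linarith) h2⟩
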